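/- Let $F$ be a 4-regular multigraph (loops and parallel edges allowed); each edge consists of two half-edges, each incident on one vertex, and every vertex is incident on four half-edges. Circuits are nonempty closed trails with a direction, considered up to cyclic permutation. An Euler system $C$ of $F$ is a set containing one Euler circuit of each connected component. A circuit partition $P$ is a partition of $E(F)$ into edge-disjoint circuits. A single transition of $P$ is the unordered pair of half-edges used in one passage of a circuit of $P$ through a vertex, and $P(x)$ is the set of the two single transitions of $P$ at $x$. Each half-edge $h$ of $F$ lies in exactly one single transition $\overline{h}$ of $P$. The touch-graph $Tch(P)$ has the circuits of $P$ as vertices and one edge $e_x$ for each $x\in V(F)$; the two half-edges of $e_x$ are the two single transitions in $P(x)$, each incident on the circuit of $P$ in which it occurs. A signed version of $C$ labels, for each vertex $x$, one of the two passages of $C$ through $x$ as $x^{+}$ and the other as $x^{-}$. Say $x^{+}$ arrives along $h_x^1$ and leaves along $h_x^2$, while $x^{-}$ arrives along $h_x^3$ and leaves along $h_x^4$. Let $\psi_C(x)=\{\{h_x^1,h_x^3\},\{h_x^2,h_x^4\}\}$. Let $C_1(C,x)$ be the closed trail that follows $C$ from $x^{-}$ to $x^{+}$. The standard-form matrix $M^0_{\mathbb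 R}(C,P)$ is the real $V(F)\times V(F)$ matrix whose $x$ row $\rho_x(M^0_{\mathbb R}(C,P))$ is obtained as follows: for each passage of $C_1(C,x)$ through a vertex $y$, arriving along $h$ and leaving along $h'$, with $\overline{h}\neq\overline{h'}$, tally $+1$ in the $y$ coordinate if $\overline{h}=\overline{h_y^1}$ and $-1$ otherwise. (That is, the row records the signed edge traversals of the image of $C_1(C,x)$ in $Tch(P)$, where $e_y$ is directed so that its initial half-edge is $\overline{h_y^1}$.) Let $\mathcal I_{\mathbb R}(C)$ be the $V(F)\times V(F)$ matrix with zero diagonal whose $xy$ entry is $1$ if $x$ and $y$ occur on a circuit of $C$ in the cyclic order $x^{+}y^{-}x^{-}y^{+}$, $-1$ if in the cyclic order $x^{+}y^{+}x^{-}y^{-}$, and $0$ otherwise. Suppose $v\ne w$ and a signed version of an Euler system $C$ includes a circuit $v^{+}T_1w^{+}T_2v^{-}T_3w^{-}T_4$. Let $C*(vw)$ be obtained from $C$ by replacing this circuit with $v^{+}T_3w^{-}T_2v^{-}T_1w^{+}T_4$, with the signs of $v,w$ as displayed and all other signs unchanged. Let $P$ be a circuit partition with $P(x)\neq\psi_C(x)$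 for all $x\in V(F)$. Then $C*(vw)$ is an Euler system with the indicated signing, and: 1. $\rho_v(M^0_{\mathbb R}(C*(vw),P))=\rho_w(M^0_{\mathbb R}(C,P))$. 2. $\rho_w(M^0_{\mathbb R}(C*(vw),P))=-\rho_v(M^0_{\mathbb R}(C,P))$. 3. If $x\in V(F)\setminus\{v,w\}$ then $$\rho_x(M^0_{\mathbb R}(C*(vw),P))=\rho_x(M^0_{\mathbb R}(C,P))+\mathcal I_{\mathbb R}(C)_{xw}\,\rho_v(M^0_{\mathbb R}(C,P))-\mathcal I_{\mathbb R}(C)_{xv}\,\rho_w(M^0_{\mathbb R}(C,P)).$$ -/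

import Mathlib

/-! Multigraphs made of half-edges, closed walks and circuits, Euler systems and circuit partitions
of 4-regular graphs, touch-graphs, signed interlacement and the standard-form matrix. -/

section Cyclic

variable {α : Type*}

/-- A cyclic sequence with the entries that fail `p` removed. -/
def cycleFilter (p : α → Bool) : Cycle α → Cycle α :=
  Quotient.map' (List.filter p) (by
    rintro l _ ⟨n, rfl⟩
    show (l.filter p).IsRotated ((l.rotate n).filter p)
    rw [List.rotate_eq_drop_append_take_mod, List.filter_append]
    conv_lhs => rw [← List.take_append_drop (n % l.length) l, List.filter_append]
    exact List.isRotated_append)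

/-- A walk is recorded by its list of steps `(hᵢ, hᵢ')`: leave along the half-edge `hᵢ`, arrive
along `hᵢ'`. For a closed walk with steps `(h₁, h₁'), …, (h_k, h_k')`, the list of its passages
through vertices is `(h₁', h₂), (h₂', h₃), …, (h_k', h₁)`: arrive along `hᵢ'`, leave along
`hᵢ₊₁`. -/
def passageList (L : List (α × α)) : List (α × α) :=
  (L.map Prod.snd).zip ((L.map Prod.fst).rotate 1)

/-- The cyclic sequence of passages of a closed walk. -/
def passages : Cycle (α × α) → Cycle (α × α) :=
  Quotient.map' passageList (by
    rintro l _ ⟨n, rfl⟩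
    refine ⟨n, ?_⟩
    show (passageList l).rotate n = passageList (l.rotate n)
    unfold passageList
    rw [List.zip_eq_zipWith, List.zip_eq_zipWith, List.zipWith_rotate_distrib _ _ _ _ (by simp),
      List.map_rotate, List.map_rotate, List.rotate_rotate, List.rotate_rotate, add_comm])

/-- The passage made when the nonempty list of steps `A` is followed by the nonempty list `B`. -/
def junction (A B : List (α × α)) (hA : A ≠ []) (hB : B ≠ []) : α × α :=
  ((A.getLast hA).2, (B.head hB).1)

theorem passageList_fst (L : List (α × α)) : (passageList L).map Prod.fst = L.map Prod.snd := by
  unfold passageList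
  rw [List.map_fst_zip]
  simp

theorem passageList_snd (L : List (α × α)) :
    (passageList L).map Prod.snd = (L.map Prod.fst).rotate 1 := by
  unfold passageList
  rw [List.map_snd_zip]
  simp

theorem exists_passage_fst (c : Cycle (α × α)) (h : α) :
    (∃ p ∈ passages c, p.1 = h) ↔ ∃ s ∈ c, s.2 = h := by
  induction c using Quotient.inductionOn' with
  | h L =>
    show (∃ p ∈ passageList L, p.1 = h) ↔ ∃ s ∈ L, s.2 = h
    have e := passageList_fst L
    rw [← List.mem_map (f := Prod.fst), e, List.mem_map]

theorem exists_passage_snd (c : Cycle (α × α)) (h : α) :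
    (∃ p ∈ passages c, p.2 = h) ↔ ∃ s ∈ c, s.1 = h := by
  induction c using Quotient.inductionOn' with
  | h L =>
    show (∃ p ∈ passageList L, p.2 = h) ↔ ∃ s ∈ L, s.1 = h
    have e := passageList_snd L
    rw [← List.mem_map (f := Prod.snd), e, List.mem_rotate, List.mem_map]

end Cyclic

/-- A multigraph (loops and parallels allowed) with vertices `V` and edges `E`; every edge consists
of exactly two half-edges, each incident on one vertex. -/
structure Multigraph (V E H : Type*) where
  vert : H → V
  edge : H → E
  two_halves : ∀ e, {h | edge h = e}.ncard = 2

/-- Every vertex has exactly four incident half-edges. -/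
structure FourRegularGraph (V E H : Type*) extends Multigraph V E H where
  four_regular : ∀ v, {h | vert h = v}.ncard = 4

namespace Multigraph

variable {V E H : Type*} (G : Multigraph V E H)

/-- Closed walks are cyclic sequences of steps: the two half-edges of a step are the two halves of
an edge, and the two half-edges of a passage are incident on the same vertex. -/
def IsClosedWalk (c : Cycle (H × H)) : Prop :=
  (∀ s ∈ c, G.edge s.1 = G.edge s.2 ∧ s.1 ≠ s.2) ∧ ∀ p ∈ passages c, G.vert p.1 = G.vert p.2

/-- A circuit is a nonempty closed trail: no edge is repeated. -/
def IsCircuit (c : Cycle (H × H)) : Prop :=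
  c ≠ Cycle.nil ∧ G.IsClosedWalk c ∧ (c.map fun s => G.edge s.1).Nodup

def Traverses (c : Cycle (H × H)) (e : E) : Prop := ∃ s ∈ c, G.edge s.1 = e

def Adj (x y : V) : Prop := ∃ h h', G.edge h = G.edge h' ∧ G.vert h = x ∧ G.vert h' = y

/-- `x` and `y` lie in the same connected component. -/
def Reachable (x y : V) : Prop := Relation.ReflTransGen G.Adj x y

/-- `c` is an Euler circuit of the connected component that contains `x`. -/
def IsEulerCircuitAt (c : Cycle (H × H)) (x : V) : Prop :=
  G.IsCircuit c ∧ ∀ e, G.Traverses c e ↔ ∃ h, G.edge h = e ∧ G.Reachable x (G.vert h)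

/-- An Euler system: a set of Euler circuits of components, one in each component. -/
def IsEulerSystem (C : Set (Cycle (H × H))) : Prop :=
  (∀ c ∈ C, ∃ x, G.IsEulerCircuitAt c x) ∧ ∀ x, ∃! c, c ∈ C ∧ G.IsEulerCircuitAt c x

/-- A partition of the edge set into pairwise edge-disjoint circuits. -/
structure CircuitPartition where
  circuits : Set (Cycle (H × H))
  isCircuit : ∀ γ ∈ circuits, G.IsCircuit γ
  existsUnique : ∀ e, ∃! γ, γ ∈ circuits ∧ G.Traverses γ e

/-- `D e` is the initial half-edge of `e` in a directed version of `G`. Coordinate `e` of `z_D(W)`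
tallies `+1` whenever `W` passes through `e` in the `D` direction, `-1` whenever it passes through
`e` in the opposite direction. -/
noncomputable def cycleVector (D : E → H) (W : Cycle (H × H)) : E → ℝ := by
  classical
  exact fun e => (W.toMultiset.map fun s : H × H =>
    if G.edge s.1 = e then (if s.1 = D e then (1 : ℝ) else -1) else 0).sum

/-- The passages through the vertex `x` made by the circuits in `C`. -/
def passagesAt (C : Set (Cycle (H × H))) (x : V) : Set (H × H) :=
  {p | (∃ c ∈ C, p ∈ passages c) ∧ G.vert p.1 = x}

/-- The transition at `x` followed by the circuits in `C`: the set of the (two) unordered pairs of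
half-edges given by the passages of `C` through `x`. For a circuit partition `P` this is `P(x)`. -/
def transition (C : Set (Cycle (H × H))) (x : V) : Set (Sym2 H) :=
  {t | ∃ p ∈ G.passagesAt C x, t = s(p.1, p.2)}

/-- The transition `ψ_C(x)`, not consistent with an orientation of the circuit of `C` at `x`: the
half-edges of arrival of the two passages through `x` are paired, and so are the half-edges of
departure. -/
def psi (C : Set (Cycle (H × H))) (x : V) : Set (Sym2 H) :=
  {t | ∃ p ∈ G.passagesAt C x, ∃ q ∈ G.passagesAt C x, p ≠ q ∧
    (t = s(p.1, q.1) ∨ t = s(p.2, q.2))}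

/-- A signed version of `C`: for each vertex `x`, one passage `σ x` through `x`, denoted `x⁺`. The
other passage of `C` through `x` is `x⁻`. -/
def IsSigning (C : Set (Cycle (H × H))) (σ : V → H × H) : Prop := ∀ x, σ x ∈ G.passagesAt C x

/-- `p` is the passage `x⁻`. -/
def IsMinus (C : Set (Cycle (H × H))) (σ : V → H × H) (x : V) (p : H × H) : Prop :=
  p ∈ G.passagesAt C x ∧ p ≠ σ x

end Multigraph

/-- Some circuit of `C` makes the four given passages in the given cyclic order. -/
def OccurInOrder {H : Type*} (C : Set (Cycle (H × H))) (p₁ p₂ p₃ p₄ : H × H) : Prop :=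
  ∃ c ∈ C, ∃ L : List (H × H), passages c = (L : Cycle (H × H)) ∧ [p₁, p₂, p₃, p₄].Sublist L

namespace Multigraph

variable {V E H : Type*} (G : Multigraph V E H)

open Classical in
/-- The signed interlacement matrix `I_ℝ(C)`: entry `1` for the order `x⁺ y⁻ x⁻ y⁺`, entry `-1` for
the order `x⁺ y⁺ x⁻ y⁻`, and `0` if `x = y` or `x`, `y` are not interlaced. -/
noncomputable def signedInterlacement (C : Set (Cycle (H × H))) (σ : V → H × H) :
    Matrix V V ℝ := fun x y =>
  if x = y then 0
  else if ∃ p q, G.IsMinus C σ x p ∧ G.IsMinus C σ y q ∧ OccurInOrder C (σ x) q p (σ y) then 1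
  else if ∃ p q, G.IsMinus C σ x p ∧ G.IsMinus C σ y q ∧ OccurInOrder C (σ x) (σ y) p q then -1
  else 0

/-- Following the list of steps `L` one follows a circuit of `C` from `x⁻` to `x⁺`, and following
`L'` one completes the circuit from `x⁺` to `x⁻`. -/
def IsFundamental (C : Set (Cycle (H × H))) (σ : V → H × H) (x : V) (L : List (H × H)) : Prop :=
  ∃ (L' : List (H × H)) (hL : L ≠ []) (hL' : L' ≠ []),
    ((L ++ L' : List (H × H)) : Cycle (H × H)) ∈ C ∧
      junction L L' hL hL' = σ x ∧ G.IsMinus C σ x (junction L' L hL' hL)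

open Classical in
/-- The fundamental circuit `C₁(C, x)`: the one that follows `C` from `x⁻` to `x⁺`, i.e. that
includes the half-edge along which the passage `x⁺` arrives. -/
noncomputable def fundamentalCircuit (C : Set (Cycle (H × H))) (σ : V → H × H) (x : V) :
    Cycle (H × H) :=
  if h : ∃ L, G.IsFundamental C σ x L then (h.choose : List (H × H)) else Cycle.nil

namespace CircuitPartition

variable {G} (P : G.CircuitPartition)

/-- A single transition of `P`: the unordered pair of half-edges of a passage of `P`. -/
def IsSingleTransition (t : Sym2 H) : Prop := ∃ γ ∈ P.circuits, ∃ p ∈ passages γ, t = s(p.1, p.2)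

/-- The half-edges of the touch-graph of `P` are the single transitions of `P`. -/
def TouchHalf : Type _ := {t : Sym2 H // P.IsSingleTransition t}

theorem edge_inj {γ : Cycle (H × H)} (hγ : γ ∈ P.circuits) {s t : H × H} (hs : s ∈ γ) (ht : t ∈ γ)
    (h : G.edge s.1 = G.edge t.1) : s = t := by
  have hn := (P.isCircuit γ hγ).2.2
  induction γ using Quotient.inductionOn' with
  | h L => exact List.inj_on_of_nodup_map (f := fun s : H × H => G.edge s.1) hn hs ht h

theorem step_edge {γ : Cycle (H × H)} (hγ : γ ∈ P.circuits) {s : H × H} (hs : s ∈ γ) :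
    G.edge s.1 = G.edge s.2 ∧ s.1 ≠ s.2 := (P.isCircuit γ hγ).2.1.1 s hs

theorem fst_inj {γ : Cycle (H × H)} (hγ : γ ∈ P.circuits) {p q : H × H} (hp : p ∈ passages γ)
    (hq : q ∈ passages γ) (h : p.1 = q.1) : p = q := by
  have key : ∀ s ∈ γ, ∀ t ∈ γ, s.2 = t.2 → s = t := fun s hs t ht e =>
    P.edge_inj hγ hs ht (by rw [(P.step_edge hγ hs).1, (P.step_edge hγ ht).1, e])
  have hn := (P.isCircuit γ hγ).2.2
  clear hγ
  induction γ using Quotient.inductionOn' with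
  | h L =>
    have hL : L.Nodup := List.Nodup.of_map _ hn
    have h1 : ((passageList L).map Prod.fst).Nodup := by
      rw [passageList_fst]
      exact List.Nodup.map_on (fun s hs t ht e => key s hs t ht e) hL
    exact List.inj_on_of_nodup_map h1 hp hq h

theorem snd_inj {γ : Cycle (H × H)} (hγ : γ ∈ P.circuits) {p q : H × H} (hp : p ∈ passages γ)
    (hq : q ∈ passages γ) (h : p.2 = q.2) : p = q := by
  have key : ∀ s ∈ γ, ∀ t ∈ γ, s.1 = t.1 → s = t := fun s hs t ht e =>
    P.edge_inj hγ hs ht (by rw [e])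
  have hn := (P.isCircuit γ hγ).2.2
  clear hγ
  induction γ using Quotient.inductionOn' with
  | h L =>
    have hL : L.Nodup := List.Nodup.of_map _ hn
    have h1 : ((passageList L).map Prod.snd).Nodup := by
      rw [passageList_snd, List.nodup_rotate]
      exact List.Nodup.map_on (fun s hs t ht e => key s hs t ht e) hL
    exact List.inj_on_of_nodup_map h1 hp hq h

theorem fst_ne_snd {γ : Cycle (H × H)} (hγ : γ ∈ P.circuits) {p q : H × H} (hp : p ∈ passages γ)
    (hq : q ∈ passages γ) : p.1 ≠ q.2 := by
  intro h
  obtain ⟨s, hs, hs'⟩ := (exists_passage_fst γ p.1).1 ⟨p, hp, rfl⟩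
  obtain ⟨t, ht, ht'⟩ := (exists_passage_snd γ q.2).1 ⟨q, hq, rfl⟩
  have e : s.2 = t.1 := by rw [hs', ht', h]
  have hst : s = t := P.edge_inj hγ hs ht (by rw [(P.step_edge hγ hs).1, e])
  subst hst
  exact (P.step_edge hγ hs).2 e.symm

theorem traverses_of_passage {γ : Cycle (H × H)} (hγ : γ ∈ P.circuits) {p : H × H}
    (hp : p ∈ passages γ) : G.Traverses γ (G.edge p.1) ∧ G.Traverses γ (G.edge p.2) := by
  obtain ⟨s, hs, hs'⟩ := (exists_passage_fst γ p.1).1 ⟨p, hp, rfl⟩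
  obtain ⟨t, ht, ht'⟩ := (exists_passage_snd γ p.2).1 ⟨p, hp, rfl⟩
  exact ⟨⟨s, hs, by rw [(P.step_edge hγ hs).1, hs']⟩, ⟨t, ht, by rw [ht']⟩⟩

/-- Every half-edge lies in exactly one single transition of `P`. -/
theorem existsUnique_single (h : H) : ∃! t : Sym2 H, P.IsSingleTransition t ∧ h ∈ t := by
  obtain ⟨γ, ⟨hγ, s, hs, hse⟩, huniq⟩ := P.existsUnique (G.edge h)
  have hmem : h = s.1 ∨ h = s.2 := by
    by_contra! hne
    have h2 := G.two_halves (G.edge h)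
    obtain ⟨a, b, hab, hS⟩ := Set.ncard_eq_two.1 h2
    have m1 : h ∈ ({a, b} : Set H) := hS ▸ rfl
    have m2 : s.1 ∈ ({a, b} : Set H) := hS ▸ hse
    have m3 : s.2 ∈ ({a, b} : Set H) := hS ▸ ((P.step_edge hγ hs).1.symm.trans hse)
    have h3 := (P.step_edge hγ hs).2
    simp only [Set.mem_insert_iff, Set.mem_singleton_iff] at m1 m2 m3
    grind
  have hex : ∃ p ∈ passages γ, h = p.1 ∨ h = p.2 := by
    rcases hmem with e | e
    · obtain ⟨p, hp, hp'⟩ := (exists_passage_snd γ h).2 ⟨s, hs, e.symm⟩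
      exact ⟨p, hp, Or.inr hp'.symm⟩
    · obtain ⟨p, hp, hp'⟩ := (exists_passage_fst γ h).2 ⟨s, hs, e.symm⟩
      exact ⟨p, hp, Or.inl hp'.symm⟩
  obtain ⟨p, hp, hhp⟩ := hex
  refine ⟨s(p.1, p.2), ⟨⟨γ, hγ, p, hp, rfl⟩, Sym2.mem_iff.2 hhp⟩, ?_⟩
  rintro t ⟨⟨γ', hγ', q, hq, rfl⟩, hhq⟩
  have hhq' := Sym2.mem_iff.1 hhq
  have ht := P.traverses_of_passage hγ' hq
  have : γ' = γ := huniq γ' ⟨hγ', by rcases hhq' with e | e <;> rw [e]; exacts [ht.1, ht.2]⟩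
  subst this
  have : q = p := by
    rcases hhq' with e | e <;> rcases hhp with e' | e'
    · exact P.fst_inj hγ hq hp (e.symm.trans e')
    · exact absurd (e.symm.trans e') (P.fst_ne_snd hγ hq hp)
    · exact absurd (e'.symm.trans e) (P.fst_ne_snd hγ hp hq)
    · exact P.snd_inj hγ hq hp (e.symm.trans e')
  rw [this]

/-- The surjection `π_P` from half-edges of the graph to half-edges of the touch-graph. -/
noncomputable def proj (h : H) : P.TouchHalf :=
  ⟨(P.existsUnique_single h).choose, (P.existsUnique_single h).choose_spec.1.1⟩

theorem mem_proj (h : H) : h ∈ (P.proj h).1 := (P.existsUnique_single h).choose_spec.1.2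

theorem proj_eq_iff (h : H) (t : P.TouchHalf) : P.proj h = t ↔ h ∈ t.1 := by
  constructor
  · rintro rfl
    exact P.mem_proj h
  · intro ht
    exact Subtype.ext ((P.existsUnique_single h).choose_spec.2 t.1 ⟨t.2, ht⟩).symm

/-- The circuit of `P` that includes the single transition `t`. -/
noncomputable def touchVert (t : P.TouchHalf) : P.circuits :=
  ⟨t.2.choose, t.2.choose_spec.1⟩

/-- The vertex of the graph at which the single transition `t` occurs. -/
noncomputable def touchEdge (t : P.TouchHalf) : V :=
  G.vert t.2.choose_spec.2.choose.1

theorem mem_touchVert (t : P.TouchHalf) :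
    ∃ p ∈ passages (P.touchVert t).1, t.1 = s(p.1, p.2) := t.2.choose_spec.2

theorem vert_of_mem (t : P.TouchHalf) {h : H} (hh : h ∈ t.1) : G.vert h = P.touchEdge t := by
  have hp := t.2.choose_spec.2.choose_spec
  have hv := (P.isCircuit _ t.2.choose_spec.1).2.1.2 _ hp.1
  rw [hp.2] at hh
  rcases Sym2.mem_iff.1 hh with e | e
  · rw [e]; rfl
  · rw [e, ← hv]; rfl

theorem touchHalf_pair (t : P.TouchHalf) : ∃ a b : H, a ≠ b ∧ t.1 = s(a, b) := by
  obtain ⟨t, γ, hγ, p, hp, e⟩ := t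
  exact ⟨p.1, p.2, P.fst_ne_snd hγ hp hp, e⟩

theorem proj_eq_iff_pair {t : P.TouchHalf} {a b : H} (e : t.1 = s(a, b)) (h : H) :
    P.proj h = t ↔ h = a ∨ h = b := by rw [P.proj_eq_iff, e, Sym2.mem_iff]

end CircuitPartition

end Multigraph

namespace FourRegularGraph

variable {V E H : Type*} (F : FourRegularGraph V E H) (P : F.toMultigraph.CircuitPartition)

theorem touch_two_halves (v : V) : {t : P.TouchHalf | P.touchEdge t = v}.ncard = 2 := by
  have h4 := F.four_regular v
  have key : ∀ t : P.TouchHalf, P.touchEdge t = v → ∃ a b, a ≠ b ∧ F.vert a = v ∧ F.vert b = v ∧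
      (∀ h, P.proj h = t ↔ h = a ∨ h = b) := by
    intro t ht
    obtain ⟨a, b, hab, e⟩ := P.touchHalf_pair t
    refine ⟨a, b, hab, ?_, ?_, P.proj_eq_iff_pair e⟩
    · rw [P.vert_of_mem t (by rw [e]; simp), ht]
    · rw [P.vert_of_mem t (by rw [e]; simp), ht]
  have hpv : ∀ h, P.touchEdge (P.proj h) = F.vert h := fun h =>
    (P.vert_of_mem _ (P.mem_proj h)).symm
  have hfin : {h | F.vert h = v}.Finite := Set.finite_of_ncard_ne_zero (by omega)
  have hne : {h | F.vert h = v}.Nonempty := Set.nonempty_of_ncard_ne_zero (by omega)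
  obtain ⟨h₀, hh₀⟩ := hne
  obtain ⟨a, b, hab, ha, hb, h1⟩ := key (P.proj h₀) ((hpv h₀).trans hh₀)
  have hex : ∃ h₁, F.vert h₁ = v ∧ h₁ ≠ a ∧ h₁ ≠ b := by
    by_contra! hcon
    have hsub : {h | F.vert h = v} ⊆ {a, b} := by
      intro h hh
      by_cases hha : h = a
      · exact Or.inl hha
      · exact Or.inr (hcon h hh hha)
    have := Set.ncard_le_ncard hsub (Set.toFinite _)
    rw [h4, Set.ncard_pair hab] at this
    omega
  obtain ⟨h₁, hh₁, hne1, hne2⟩ := hex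
  obtain ⟨c, d, hcd, hc, hd, h2⟩ := key (P.proj h₁) ((hpv h₁).trans hh₁)
  have hne : P.proj h₀ ≠ P.proj h₁ := fun e => by
    have := (h1 h₁).1 e.symm
    tauto
  have hall : ∀ h, F.vert h = v → h = a ∨ h = b ∨ h = c ∨ h = d := by
    intro h hh
    by_contra! hcon
    obtain ⟨n1, n2, n3, n4⟩ := hcon
    have hac : a ≠ c := fun e => hne (by rw [← (h1 a).2 (Or.inl rfl), (h2 a).2 (Or.inl e)])
    have had : a ≠ d := fun e => hne (by rw [← (h1 a).2 (Or.inl rfl), (h2 a).2 (Or.inr e)])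
    have hbc : b ≠ c := fun e => hne (by rw [← (h1 b).2 (Or.inr rfl), (h2 b).2 (Or.inl e)])
    have hbd : b ≠ d := fun e => hne (by rw [← (h1 b).2 (Or.inr rfl), (h2 b).2 (Or.inr e)])
    have hsub : ({h, a, b, c, d} : Set H) ⊆ {h | F.vert h = v} := by
      rintro x (rfl | rfl | rfl | rfl | rfl) <;> assumption
    have hle := Set.ncard_le_ncard hsub hfin
    classical
    have hc5 : ({h, a, b, c, d} : Set H).ncard = 5 := by
      have : ({h, a, b, c, d} : Set H) = (({h, a, b, c, d} : Finset H) : Set H) := by simp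
      rw [this, Set.ncard_coe_finset]
      simp [*]
    omega
  have hset : {t : P.TouchHalf | P.touchEdge t = v} = {P.proj h₀, P.proj h₁} := by
    ext t
    simp only [Set.mem_ofPred_eq, Set.mem_insert_iff, Set.mem_singleton_iff]
    constructor
    · intro ht
      obtain ⟨x, y, -, hx, -, h3⟩ := key t ht
      have hxt : P.proj x = t := (h3 x).2 (Or.inl rfl)
      rcases hall x hx with e | e | e | e
      · exact Or.inl (hxt.symm.trans ((h1 x).2 (Or.inl e)))
      · exact Or.inl (hxt.symm.trans ((h1 x).2 (Or.inr e)))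
      · exact Or.inr (hxt.symm.trans ((h2 x).2 (Or.inl e)))
      · exact Or.inr (hxt.symm.trans ((h2 x).2 (Or.inr e)))
    · rintro (rfl | rfl)
      · exact (hpv h₀).trans hh₀
      · exact (hpv h₁).trans hh₁
  rw [hset, Set.ncard_pair hne]

/-- The touch-graph `Tch(P)`: its vertices are the circuits of `P`, its edges are the vertices of
`F`, and the two half-edges of the edge `e_v` are the two single transitions of `P` at `v`, each
incident on the circuit of `P` that makes it. -/
noncomputable def touchGraph : Multigraph P.circuits V P.TouchHalf where
  vert := P.touchVert
  edge := P.touchEdge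
  two_halves := F.touch_two_halves P

open Classical in
/-- The closed walk `π_P(W)` in the touch-graph: each passage `(h, h')` of `W` through a vertex `x`
becomes a traversal of the edge `e_x` from `π_P(h)` to `π_P(h')`, and is removed if
`π_P(h) = π_P(h')`. -/
noncomputable def projWalk (W : Cycle (H × H)) : Cycle (P.TouchHalf × P.TouchHalf) :=
  cycleFilter (fun t => decide (t.1 ≠ t.2)) ((passages W).map (Prod.map P.proj P.proj))

/-- The standard form `M⁰_ℝ(C, P)` for the signed version `σ` of `C`: its `x` row is
`z_D(π_P(C₁(C, x)))`, where `D` directs each edge `e_y` of the touch-graph so that its initial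
half-edge is the image of the half-edge along which the passage `y⁺` arrives. -/
noncomputable def standardForm (C : Set (Cycle (H × H))) (σ : V → H × H) : Matrix V V ℝ :=
  fun x => (F.touchGraph P).cycleVector (fun y => P.proj (σ y).1)
    (F.projWalk P (F.fundamentalCircuit C σ x))

end FourRegularGraph

/-- `C` with the circuit `A₁ A₂ A₃ A₄` replaced by the circuit `A₃ A₂ A₁ A₄`. If `A₁` and `A₃` are
the two trails from `v` to `w` in a circuit of `C`, this is the transposition `C * (vw)`. -/
def transposition {H : Type*} (C : Set (Cycle (H × H))) (A₁ A₂ A₃ A₄ : List (H × H)) :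
    Set (Cycle (H × H)) :=
  (C \ {((A₁ ++ A₂ ++ A₃ ++ A₄ : List (H × H)) : Cycle (H × H))}) ∪
    {((A₃ ++ A₂ ++ A₁ ++ A₄ : List (H × H)) : Cycle (H × H))}

open Classical in
/-- The signing that agrees with `σ` except that `v⁺` is the passage `pv` and `w⁺` is `pw`. -/
noncomputable def resign {V H : Type*} (σ : V → H × H) (v w : V) (pv pw : H × H) : V → H × H :=
  fun x => if x = v then pv else if x = w then pw else σ x

/-! Fix a coordinate `y` and let `t` be the initial half-edge of `e_y`. With `1_t` the indicator of
the half-edges projecting to `t`, a passage `(h, h')` contributes `1_t(h) - 1_t(h')` to the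
coordinate. Around a closed walk these terms can be regrouped by steps, so the coordinate is a sum
of gains `1_t(s.2) - 1_t(s.1)` (`cycleVector_projWalk`). The hypothesis `P(y) ≠ ψ_C(y)` says exactly
that the two passages at `y` do not both contribute `1`; their total is then `0`, and so each
circuit of `C` has total gain `0` (`sum_gain_eq_zero`).

Write `aᵢ` for the gain of the arc `Aᵢ`, so `a₁ + a₂ + a₃ + a₄ = 0`. Row `v` is `a₃ + a₄` and row
`w` is `a₄ + a₁`. After the exchange, row `v` is `a₁ + a₄` and row `w` is `a₂ + a₁ = -(a₃ + a₄)`,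
which gives the first two identities.

For other `x`, zero total gain yields a potential `β` on the half-edges of departure, and row `x` is
`β` at the exit of `x⁺` minus `β` at the exit of `x⁻` (`standardForm_apply`). The exchange adds `(a₃
+ a₄)·1_{A₂A₃} - (a₄ + a₁)·1_{A₁A₂}` to `β` (`IsPotential.transpose`). The differences of these two
arc indicators between the exits of `x⁺` and `x⁻` are the signed interlacements of `x` with `w` and
with `v` (`signedInterlacement_eq`). -/

section Lists

variable {α : Type*}

/-! ### Cutting cyclic lists of steps into arcs. -/

/-- The passages strictly inside a list of steps. -/
def innerPassages (L : List (α × α)) : List (α × α) :=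
  (L.map Prod.snd).zip (L.map Prod.fst).tail

theorem innerPassages_append (A B : List (α × α)) (hA : A ≠ []) (hB : B ≠ []) :
    innerPassages (A ++ B) = innerPassages A ++ junction A B hA hB :: innerPassages B := by
  induction A with
  | nil => exact absurd rfl hA
  | cons a A ih =>
    cases A with
    | nil =>
      cases B with
      | nil => exact absurd rfl hB
      | cons b B => simp [innerPassages, junction]
    | cons a' A =>
      have := ih (by simp)
      simp only [innerPassages, junction, List.cons_append, List.map_cons, List.tail_cons,
        List.zip_cons_cons] at this ⊢
      rw [this]
      simp

theorem passageList_eq (A : List (α × α)) (hA : A ≠ []) :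
    passageList A = innerPassages A ++ [junction A A hA hA] := by
  -- The half-edge `z` rotated to the end is kept arbitrary, because the induction discards the head
  -- that it came from.
  have key : ∀ (A : List (α × α)) (hA : A ≠ []) (z : α),
      (A.map Prod.snd).zip ((A.map Prod.fst).tail ++ [z]) =
        innerPassages A ++ [((A.getLast hA).2, z)] := by
    intro A
    induction A with
    | nil => intro h; exact absurd rfl h
    | cons a A ih =>
      intro _ z
      cases A with
      | nil => simp [innerPassages]
      | cons b B => simpa [innerPassages] using ih (by simp) z
  cases A with
  | nil => exact absurd rfl hA
  | cons a A => simpa [passageList, junction] using key (a :: A) hA a.1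

theorem passageList_append (A B : List (α × α)) (hA : A ≠ []) (hB : B ≠ []) :
    passageList (A ++ B) =
      innerPassages A ++ junction A B hA hB :: (innerPassages B ++ [junction B A hB hA]) := by
  rw [passageList_eq _ (by simp [hA]), innerPassages_append A B hA hB]
  simp [junction, List.getLast_append_of_ne_nil, hB, List.head_append_of_ne_nil, hA]

theorem junction_append_left (A B C : List (α × α)) (hB : B ≠ []) (hC : C ≠ [])
    (h : A ++ B ≠ []) : junction (A ++ B) C h hC = junction B C hB hC := by
  simp [junction, List.getLast_append_of_ne_nil, hB]

theorem junction_append_right (A B C : List (α × α)) (hA : A ≠ []) (hB : B ≠ [])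
    (h : B ++ C ≠ []) : junction A (B ++ C) hA h = junction A B hA hB := by
  simp [junction, List.head_append_of_ne_nil, hB]

/-- Separates the inner passages, which do not depend on the order of the arcs, from the four
junctions, the only passages that an exchange of arcs can alter. -/
theorem mem_passageList_append₄ {A B C D : List (α × α)} (hA : A ≠ []) (hB : B ≠ [])
    (hC : C ≠ []) (hD : D ≠ []) (q : α × α) :
    q ∈ passageList (A ++ B ++ C ++ D) ↔
      (q ∈ innerPassages A ∨ q ∈ innerPassages B ∨ q ∈ innerPassages C ∨ q ∈ innerPassages D) ∨
        q = junction A B hA hB ∨ q = junction B C hB hC ∨ q = junction C D hC hD ∨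
          q = junction D A hD hA := by
  have hAB : A ++ B ≠ [] := by simp [hA]
  have hABC : A ++ B ++ C ≠ [] := by simp [hA]
  have hBC : B ++ C ≠ [] := by simp [hB]
  rw [passageList_append (A ++ B ++ C) D hABC hD, innerPassages_append (A ++ B) C hAB hC,
    innerPassages_append A B hA hB, junction_append_left (A ++ B) C D hC hD,
    junction_append_left A B C hB hC]
  have : junction D (A ++ B ++ C) hD hABC = junction D A hD hA := by
    simp [junction, List.head_append_of_ne_nil, hA]
  rw [this]
  simp only [List.mem_append, List.mem_cons, List.not_mem_nil, or_false]
  tauto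

theorem innerPassages_snd_mem {L : List (α × α)} {p : α × α} (hp : p ∈ innerPassages L) :
    p.2 ∈ L.map Prod.fst :=
  List.mem_of_mem_tail (List.of_mem_zip (a := p.1) (b := p.2) hp).2

theorem exists_junction_of_mem_inner {L : List (α × α)} {p : α × α} (hp : p ∈ innerPassages L) :
    ∃ A B, ∃ (hA : A ≠ []) (hB : B ≠ []), L = A ++ B ∧ p = junction A B hA hB := by
  induction L with
  | nil => simp [innerPassages] at hp
  | cons a L ih =>
    cases L with
    | nil => simp [innerPassages] at hp
    | cons b L =>
      have : p = (a.2, b.1) ∨ p ∈ innerPassages (b :: L) := by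
        simpa [innerPassages] using hp
      rcases this with rfl | h
      · exact ⟨[a], b :: L, by simp, by simp, rfl, rfl⟩
      · obtain ⟨A, B, hA, hB, e, rfl⟩ := ih h
        exact ⟨a :: A, B, by simp, hB, by simp [e], by simp [junction, hA]⟩

/-- A cyclic list with two different passages is cut by them into two arcs. -/
theorem exists_cut {M : List (α × α)} {p q : α × α} (hp : p ∈ passageList M)
    (hq : q ∈ passageList M) (hpq : p ≠ q) :
    ∃ A B, ∃ (hA : A ≠ []) (hB : B ≠ []), M.IsRotated (A ++ B) ∧ junction A B hA hB = p ∧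
      junction B A hB hA = q := by
  have hM : M ≠ [] := by rintro rfl; simp [passageList] at hp
  -- Rotate until `q` is the closing passage; then `p`, being different, is an inner passage and
  -- marks the cut.
  have start : ∃ N, ∃ hN : N ≠ [], M.IsRotated N ∧ junction N N hN hN = q := by
    rw [passageList_eq M hM, List.mem_append, List.mem_singleton] at hq
    rcases hq with hq | rfl
    · obtain ⟨A, B, hA, hB, rfl, rfl⟩ := exists_junction_of_mem_inner hq
      exact ⟨B ++ A, by simp [hA], List.isRotated_append, by
        simp [junction, List.getLast_append_of_ne_nil, hA, List.head_append_of_ne_nil, hB]⟩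
    · exact ⟨M, hM, List.IsRotated.refl _, rfl⟩
  obtain ⟨N, hN, hMN, rfl⟩ := start
  have hp' : p ∈ passageList N := by
    have h1 : p ∈ passages (M : Cycle (α × α)) := hp
    rwa [Cycle.coe_eq_coe.2 hMN] at h1
  rw [passageList_eq N hN, List.mem_append, List.mem_singleton] at hp'
  rcases hp' with hp' | rfl
  · obtain ⟨A, B, hA, hB, rfl, rfl⟩ := exists_junction_of_mem_inner hp'
    refine ⟨A, B, hA, hB, hMN, rfl, ?_⟩
    simp [junction, List.getLast_append_of_ne_nil, hB, List.head_append_of_ne_nil, hA]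
  · exact absurd rfl hpq

/-- A nontrivial rotation swaps two nonempty blocks, and `d` would have to end both of them. -/
theorem List.Nodup.eq_of_isRotated_append_singleton {A B : List α} {d : α}
    (hn : (A ++ [d]).Nodup) (h : (A ++ [d]).IsRotated (B ++ [d])) : A = B := by
  obtain ⟨X, Y, h1, h2⟩ : ∃ X Y, A ++ [d] = X ++ Y ∧ B ++ [d] = Y ++ X := by
    obtain ⟨n, hn⟩ := h
    rw [List.rotate_eq_drop_append_take_mod] at hn
    exact ⟨_, _, (List.take_append_drop _ _).symm, hn.symm⟩
  rcases List.eq_nil_or_concat X with rfl | ⟨X, x, rfl⟩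
  · simp only [List.nil_append, List.append_nil] at h1 h2
    exact List.append_cancel_right (h1.trans h2.symm)
  rcases List.eq_nil_or_concat Y with rfl | ⟨Y, y, rfl⟩
  · simp only [List.nil_append, List.append_nil] at h1 h2
    exact List.append_cancel_right (h1.trans h2.symm)
  exfalso
  have e1 : d = y := by
    rw [List.concat_eq_append, List.concat_eq_append, ← List.append_assoc] at h1
    simpa using (List.append_inj' h1 rfl).2
  have e2 : d = x := by
    rw [List.concat_eq_append, List.concat_eq_append, ← List.append_assoc] at h2
    simpa using (List.append_inj' h2 rfl).2
  subst e1
  subst e2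
  rw [h1] at hn
  simp [List.nodup_append] at hn

/-- Two points `c`, `d` cut a cyclic list without repetitions into two arcs, and `a`, `b` are on
different arcs if the cyclic order is `a c b d`. -/
theorem mem_arcs_of_sublist {L B B' : List α} {a b c d : α} (hn : L.Nodup)
    (hL : L.IsRotated (B ++ c :: (B' ++ [d]))) (hs : [a, c, b, d].Sublist L) :
    a ∈ B ∧ b ∈ B' := by
  rw [List.cons_sublist_iff] at hs
  obtain ⟨r1, r, rfl, h1, hs⟩ := hs
  rw [List.cons_sublist_iff] at hs
  obtain ⟨r2, r', rfl, h2, hs⟩ := hs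
  rw [List.cons_sublist_iff] at hs
  obtain ⟨r3, r4, rfl, h3, hs⟩ := hs
  rw [List.singleton_sublist] at hs
  obtain ⟨y1, y2, rfl⟩ := List.append_of_mem h2
  obtain ⟨z1, z2, rfl⟩ := List.append_of_mem hs
  -- Once `d` is rotated to the end, the rotation becomes an equality; the single occurrence of `c`
  -- then matches the two arcs.
  have e : ((z2 ++ r1 ++ y1 ++ c :: y2 ++ r3 ++ z1) ++ [d]).IsRotated
      ((B ++ c :: B') ++ [d]) := by
    refine List.IsRotated.trans ?_ (by simpa using hL)
    have := List.isRotated_append (l := z2) (l' := r1 ++ y1 ++ c :: y2 ++ r3 ++ z1 ++ [d])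
    simpa using this
  have hn' : ((z2 ++ r1 ++ y1 ++ c :: y2 ++ r3 ++ z1) ++ [d]).Nodup := by
    rw [e.nodup_iff]
    rw [hL.nodup_iff] at hn
    simpa using hn
  have e' := hn'.eq_of_isRotated_append_singleton e
  have hn2 := hn'.of_append_left
  have e'' : (z2 ++ r1 ++ y1) ++ c :: (y2 ++ r3 ++ z1) = B ++ c :: B' := by simpa using e'
  have hc1 : c ∉ z2 ++ r1 ++ y1 := by
    intro hc
    have : ((z2 ++ r1 ++ y1) ++ c :: (y2 ++ r3 ++ z1)).Nodup := by simpa using hn2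
    exact (List.disjoint_of_nodup_append this) hc (by simp)
  have hc2 : c ∉ y2 ++ r3 ++ z1 := by
    intro hc
    have : ((z2 ++ r1 ++ y1) ++ c :: (y2 ++ r3 ++ z1)).Nodup := by simpa using hn2
    exact (List.nodup_cons.1 this.of_append_right).1 hc
  obtain ⟨rfl, -, rfl⟩ := (List.append_cons_inj_of_notMem hc1 hc2).1 e''
  exact ⟨by simp [h1], by simp [h3]⟩

/-! ### Potentials along lists of steps. -/

/-- `β h` is `a` plus the sum of `g` over the steps of `L` that precede the step along `h`. -/
def IsPotential (g : α × α → ℝ) (β : α → ℝ) (L : List (α × α)) (a : ℝ) : Prop :=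
  ∀ X s Y, L = X ++ s :: Y → β s.1 = a + (X.map g).sum

theorem isPotential_append {g : α × α → ℝ} {β : α → ℝ} {L L' : List (α × α)} {a : ℝ} :
    IsPotential g β (L ++ L') a ↔
      IsPotential g β L a ∧ IsPotential g β L' (a + (L.map g).sum) := by
  constructor
  · intro h
    refine ⟨fun X s Y e => h X s (Y ++ L') (by simp [e]), fun X s Y e => ?_⟩
    rw [h (L ++ X) s Y (by simp [e])]
    simp [add_assoc]
  · rintro ⟨h1, h2⟩ X s Y e
    rcases List.append_eq_append_iff.1 e with ⟨Z, rfl, e'⟩ | ⟨Z, rfl, e'⟩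
    · rw [h2 Z s Y e']
      simp [add_assoc]
    · cases Z with
      | nil =>
        rw [h2 [] s Y (by simpa using e'.symm)]
        simp
      | cons z Z =>
        simp only [List.cons_append, List.cons.injEq] at e'
        obtain ⟨rfl, rfl⟩ := e'
        exact h1 X s Z rfl

theorem isPotential_cons {g : α × α → ℝ} {β : α → ℝ} {s : α × α} {L : List (α × α)} {a : ℝ} :
    IsPotential g β (s :: L) a ↔ β s.1 = a ∧ IsPotential g β L (a + g s) := by
  have := isPotential_append (g := g) (β := β) (L := [s]) (L' := L) (a := a)
  simp only [List.singleton_append, List.map_cons, List.map_nil, List.sum_singleton] at this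
  rw [this]
  refine and_congr_left fun _ => ⟨fun h => by simpa using h [] s [] rfl, fun h X t Y e => ?_⟩
  cases X with
  | nil => simp at e; simp [← e.1, h]
  | cons x X => simp at e

/-- An arc moved elsewhere in a circuit only changes its starting value, so its potential shifts by
a constant. -/
theorem IsPotential.congr {g : α × α → ℝ} {β β' : α → ℝ} {L : List (α × α)} {a k : ℝ}
    (h : IsPotential g β L a) (hk : ∀ x ∈ L.map Prod.fst, β' x = β x + k) :
    IsPotential g β' L (a + k) := by
  intro X s Y e
  rw [hk _ (List.mem_map_of_mem (by simp [e])), h X s Y e]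
  ring

/-- Partial sums define a function of the half-edge because no half-edge of departure repeats. -/
theorem exists_isPotential (g : α × α → ℝ) {L : List (α × α)} (hn : (L.map Prod.fst).Nodup)
    (a : ℝ) : ∃ β, IsPotential g β L a := by
  classical
  induction L generalizing a with
  | nil => exact ⟨0, fun X s Y e => by simp at e⟩
  | cons s L ih =>
    rw [List.map_cons, List.nodup_cons] at hn
    obtain ⟨β, hβ⟩ := ih hn.2 (a + g s)
    refine ⟨Function.update β s.1 a, isPotential_cons.2 ⟨by simp, ?_⟩⟩
    rw [← add_zero (a + g s)]
    refine hβ.congr fun x hx => ?_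
    rw [Function.update_of_ne (by rintro rfl; exact hn.1 hx), add_zero]

/-- With zero total there is no jump at the base point, so the same `β` serves every starting point
of the cycle. -/
theorem IsPotential.isRotated {g : α × α → ℝ} {β : α → ℝ} {L L' : List (α × α)} {a : ℝ}
    (h : IsPotential g β L a) (h0 : (L.map g).sum = 0) (hr : L.IsRotated L') :
    ∃ b, IsPotential g β L' b := by
  obtain ⟨n, rfl⟩ := hr
  rw [List.rotate_eq_drop_append_take_mod]
  rw [← List.take_append_drop (n % L.length) L] at h h0
  rw [isPotential_append] at h
  refine ⟨_, isPotential_append.2 ⟨h.2, ?_⟩⟩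
  rw [List.map_append, List.sum_append] at h0
  rw [add_assoc, h0, add_zero]
  exact h.1

theorem IsPotential.head {g : α × α → ℝ} {β : α → ℝ} {L : List (α × α)} {a : ℝ}
    (h : IsPotential g β L a) (hL : L ≠ []) : β (L.head hL).1 = a := by
  cases L with
  | nil => exact absurd rfl hL
  | cons s L => exact (isPotential_cons.1 h).1

theorem IsPotential.sum_eq {g : α × α → ℝ} {β : α → ℝ} {L L' : List (α × α)} {a : ℝ}
    (h : IsPotential g β (L ++ L') a) (hL : L ≠ []) (hL' : L' ≠ []) :
    (L.map g).sum = β (L'.head hL').1 - β (L.head hL).1 := by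
  rw [isPotential_append] at h
  rw [h.1.head hL, h.2.head hL']
  ring

/-- Summation by parts around a cycle: passages and steps pair the same arrivals and departures
differently. -/
theorem sum_passageList (τ : α → ℝ) (L : List (α × α)) :
    ((passageList L).map fun p => τ p.1 - τ p.2).sum = (L.map fun s => τ s.2 - τ s.1).sum := by
  have key : ∀ (f g : α × α → ℝ) (N : List (α × α)),
      (N.map fun s => f s - g s).sum = (N.map f).sum - (N.map g).sum := fun f g N => by
    induction N with
    | nil => simp
    | cons s N ih => simp only [List.map_cons, List.sum_cons, ih]; ring
  rw [key, key]
  congr 1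
  · rw [← Function.comp_def τ Prod.fst, ← List.map_map, passageList_fst, List.map_map]
    rfl
  · rw [← Function.comp_def τ Prod.snd, ← List.map_map, passageList_snd,
      ← Function.comp_def τ Prod.fst, ← List.map_map]
    exact ((List.rotate_perm _ _).map τ).sum_eq

end Lists

/-! ### Euler systems as circuit partitions, and uniqueness of passages. -/

namespace Multigraph

variable {V E H : Type*} {G : Multigraph V E H} {C : Set (Cycle (H × H))}

theorem Reachable.symm {x y : V} (h : G.Reachable x y) : G.Reachable y x :=
  have : Std.Symm G.Adj := ⟨fun _ _ ⟨h, h', e, hx, hy⟩ => ⟨h', h, e.symm, hy, hx⟩⟩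
  (inferInstance : Std.Symm (Relation.ReflTransGen G.Adj)).symm _ _ h

theorem reachable_of_edge_eq {h h' : H} (e : G.edge h = G.edge h') :
    G.Reachable (G.vert h) (G.vert h') :=
  Relation.ReflTransGen.single ⟨h, h', e, rfl, rfl⟩

theorem IsEulerCircuitAt.of_reachable {c : Cycle (H × H)} {x y : V} (hc : G.IsEulerCircuitAt c x)
    (h : G.Reachable x y) : G.IsEulerCircuitAt c y :=
  ⟨hc.1, fun e => (hc.2 e).trans ⟨fun ⟨k, hk, hr⟩ => ⟨k, hk, h.symm.trans hr⟩,
    fun ⟨k, hk, hr⟩ => ⟨k, hk, h.trans hr⟩⟩⟩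

theorem IsEulerSystem.isEulerCircuitAt_vert (hC : G.IsEulerSystem C) {c : Cycle (H × H)}
    (hc : c ∈ C) {h : H} (ht : G.Traverses c (G.edge h)) : G.IsEulerCircuitAt c (G.vert h) := by
  obtain ⟨x, hx⟩ := hC.1 c hc
  obtain ⟨k, hk, hr⟩ := (hx.2 _).1 ht
  exact hx.of_reachable (hr.trans (reachable_of_edge_eq hk))

/-- The circuits of an Euler system partition the edges. -/
def IsEulerSystem.toCircuitPartition (hC : G.IsEulerSystem C) : G.CircuitPartition where
  circuits := C
  isCircuit := fun γ hγ => (hC.1 γ hγ).choose_spec.1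
  existsUnique := fun e => by
    obtain ⟨h, rfl⟩ : {h | G.edge h = e}.Nonempty :=
      Set.nonempty_of_ncard_ne_zero (by rw [G.two_halves e]; decide)
    obtain ⟨c, ⟨hc, hcx⟩, hu⟩ := hC.2 (G.vert h)
    refine ⟨c, ⟨hc, (hcx.2 _).2 ⟨h, rfl, Relation.ReflTransGen.refl⟩⟩, ?_⟩
    rintro d ⟨hd, ht⟩
    exact hu d ⟨hd, hC.isEulerCircuitAt_vert hd ht⟩

/-- The edge of `h` determines the circuit, and a trail traverses that edge once, so `h` serves one
passage only, either as arrival or as departure. -/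
theorem CircuitPartition.passage_unique (Q : G.CircuitPartition) {γ γ' : Cycle (H × H)}
    (hγ : γ ∈ Q.circuits) (hγ' : γ' ∈ Q.circuits) {p q : H × H} (hp : p ∈ passages γ)
    (hq : q ∈ passages γ') {h : H} (hhp : h = p.1 ∨ h = p.2) (hhq : h = q.1 ∨ h = q.2) :
    γ = γ' ∧ p = q := by
  have tp := Q.traverses_of_passage hγ hp
  have tq := Q.traverses_of_passage hγ' hq
  obtain ⟨δ, -, hu⟩ := Q.existsUnique (G.edge h)
  have e : γ = γ' := (hu γ ⟨hγ, by rcases hhp with rfl | rfl; exacts [tp.1, tp.2]⟩).trans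
    (hu γ' ⟨hγ', by rcases hhq with rfl | rfl; exacts [tq.1, tq.2]⟩).symm
  subst e
  refine ⟨rfl, ?_⟩
  rcases hhp with rfl | rfl <;> rcases hhq with e | e
  · exact Q.fst_inj hγ hp hq e
  · exact absurd e (Q.fst_ne_snd hγ hp hq)
  · exact absurd e.symm (Q.fst_ne_snd hγ hq hp)
  · exact Q.snd_inj hγ hp hq e

theorem CircuitPartition.nodup_passages (Q : G.CircuitPartition) {γ : Cycle (H × H)}
    (hγ : γ ∈ Q.circuits) : (passages γ).Nodup := by
  have hn := (Q.isCircuit γ hγ).2.2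
  have hst := fun s hs => (Q.isCircuit γ hγ).2.1.1 s hs
  clear hγ
  induction γ using Quotient.inductionOn' with
  | h L =>
    refine List.Nodup.of_map Prod.fst (?_ : ((passageList L).map Prod.fst).Nodup)
    rw [passageList_fst]
    refine List.Nodup.of_map G.edge ?_
    have hn' : (L.map fun s => G.edge s.1).Nodup := hn
    rw [List.map_map]
    convert hn' using 1
    exact List.map_congr_left fun s hs => (hst s hs).1.symm

theorem CircuitPartition.nodup_map_fst (Q : G.CircuitPartition) {M : List (H × H)}
    (hM : (M : Cycle (H × H)) ∈ Q.circuits) : (M.map Prod.fst).Nodup := by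
  have hn : (M.map fun s => G.edge s.1).Nodup := (Q.isCircuit _ hM).2.2
  refine List.Nodup.of_map G.edge ?_
  rwa [List.map_map]

theorem CircuitPartition.exists_passage (Q : G.CircuitPartition) {γ : Cycle (H × H)}
    (hγ : γ ∈ Q.circuits) {h : H} (ht : G.Traverses γ (G.edge h)) :
    ∃ p ∈ passages γ, h = p.1 ∨ h = p.2 := by
  obtain ⟨t, ⟨⟨γ', hγ', p, hp, rfl⟩, hh⟩, -⟩ := Q.existsUnique_single h
  rw [Sym2.mem_iff] at hh
  have tp := Q.traverses_of_passage hγ' hp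
  have e := (Q.existsUnique (G.edge h)).unique ⟨hγ, ht⟩
    ⟨hγ', by rcases hh with rfl | rfl; exacts [tp.1, tp.2]⟩
  subst e
  exact ⟨p, hp, hh⟩

theorem CircuitPartition.vert_passage (Q : G.CircuitPartition) {γ : Cycle (H × H)}
    (hγ : γ ∈ Q.circuits) {p : H × H} (hp : p ∈ passages γ) : G.vert p.1 = G.vert p.2 :=
  (Q.isCircuit γ hγ).2.1.2 p hp

theorem CircuitPartition.touchEdge_proj (Q : G.CircuitPartition) (h : H) :
    Q.touchEdge (Q.proj h) = G.vert h := (Q.vert_of_mem _ (Q.mem_proj h)).symm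

open Classical in
/-- The indicator function of the half-edges that project to the half-edge `t` of the touch-graph. -/
noncomputable def CircuitPartition.indicator (Q : G.CircuitPartition) (t : Q.TouchHalf) (h : H) :
    ℝ :=
  if Q.proj h = t then 1 else 0

/-- The contribution of a step to the coordinate of a projected walk in the touch-graph that belongs
to an edge with initial half-edge `t`. -/
noncomputable def CircuitPartition.gain (Q : G.CircuitPartition) (t : Q.TouchHalf) (s : H × H) :
    ℝ :=
  Q.indicator t s.2 - Q.indicator t s.1

end Multigraph

/-! ### The two passages at a vertex. -/

namespace FourRegularGraph

variable {V E H : Type*} {F : FourRegularGraph V E H} {C : Set (Cycle (H × H))} {σ : V → H × H}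

/-- Each vertex `x` is passed exactly twice by an Euler system, by the same circuit, and the
two passages `x⁺`, `x⁻` involve all four half-edges at `x`. -/
theorem exists_minus (hC : F.IsEulerSystem C) (hσ : F.IsSigning C σ) (x : V) :
    ∃ d ∈ C, ∃ p, σ x ∈ passages d ∧ p ∈ passages d ∧ F.IsMinus C σ x p ∧
      (∀ q, q ∈ F.passagesAt C x ↔ q = σ x ∨ q = p) ∧
      (∀ h, F.vert h = x ↔ h = (σ x).1 ∨ h = (σ x).2 ∨ h = p.1 ∨ h = p.2) ∧
      [(σ x).1, (σ x).2, p.1, p.2].Nodup := by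
  let Q := hC.toCircuitPartition
  have h4 := F.four_regular x
  have hfin : {h | F.vert h = x}.Finite := Set.finite_of_ncard_ne_zero (by omega)
  obtain ⟨⟨d, hd, hσd⟩, hv1⟩ := hσ x
  have hv2 : F.vert (σ x).2 = x := (Q.vert_passage hd hσd).symm.trans hv1
  obtain ⟨h, hh, hne1, hne2⟩ : ∃ h, F.vert h = x ∧ h ≠ (σ x).1 ∧ h ≠ (σ x).2 := by
    by_contra! hcon
    have hsub : {h | F.vert h = x} ⊆ {(σ x).1, (σ x).2} := by
      intro h hh
      by_cases hha : h = (σ x).1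
      · exact Or.inl hha
      · exact Or.inr (hcon h hh hha)
    have := Set.ncard_le_ncard hsub (Set.toFinite _)
    have := Set.ncard_insert_le (σ x).1 {(σ x).2}
    rw [Set.ncard_singleton] at this
    omega
  have hdx : F.IsEulerCircuitAt d x := by
    have := hC.isEulerCircuitAt_vert hd (Q.traverses_of_passage hd hσd).1
    rwa [hv1] at this
  -- The Euler circuit `d` covers the whole component, so the passage using the spare half-edge `h`
  -- lies on `d` too; it is `x⁻`.
  obtain ⟨p, hp, hhp⟩ := Q.exists_passage hd
    ((hdx.2 (F.edge h)).2 ⟨h, rfl, by rw [hh]; exact Relation.ReflTransGen.refl⟩)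
  have hpσ : p ≠ σ x := by
    rintro rfl
    tauto
  have hp12 := Q.vert_passage hd hp
  have hp1 : F.vert p.1 = x := by
    rcases hhp with rfl | rfl
    · exact hh
    · exact hp12.trans hh
  have hp2 : F.vert p.2 = x := hp12.symm.trans hp1
  have hnd : [(σ x).1, (σ x).2, p.1, p.2].Nodup := by
    have a1 : (σ x).1 ≠ (σ x).2 := Q.fst_ne_snd hd hσd hσd
    have a2 : p.1 ≠ p.2 := Q.fst_ne_snd hd hp hp
    have a3 : (σ x).1 ≠ p.1 := fun e =>
      hpσ (Q.passage_unique hd hd hp hσd (Or.inl e) (Or.inl rfl)).2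
    have a4 : (σ x).1 ≠ p.2 := fun e =>
      hpσ (Q.passage_unique hd hd hp hσd (Or.inr e) (Or.inl rfl)).2
    have a5 : (σ x).2 ≠ p.1 := fun e =>
      hpσ (Q.passage_unique hd hd hp hσd (Or.inl e) (Or.inr rfl)).2
    have a6 : (σ x).2 ≠ p.2 := fun e =>
      hpσ (Q.passage_unique hd hd hp hσd (Or.inr e) (Or.inr rfl)).2
    simp [a1, a2, a3, a4, a5, a6]
  have hall : ∀ h, F.vert h = x ↔ h = (σ x).1 ∨ h = (σ x).2 ∨ h = p.1 ∨ h = p.2 := by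
    classical
    have hc4 : (([(σ x).1, (σ x).2, p.1, p.2].toFinset : Finset H) : Set H).ncard = 4 := by
      rw [Set.ncard_coe_finset, List.toFinset_card_of_nodup hnd]
      rfl
    have hset := Set.eq_of_subset_of_ncard_le
      (s := (([(σ x).1, (σ x).2, p.1, p.2].toFinset : Finset H) : Set H))
      (t := {h | F.vert h = x}) (by
        intro h hh
        simp at hh
        rcases hh with rfl | rfl | rfl | rfl <;> assumption) (by rw [hc4, h4]) hfin
    intro h
    have := Set.ext_iff.1 hset h
    simp at this
    exact this.symm
  refine ⟨d, hd, p, hσd, hp, ⟨⟨⟨d, hd, hp⟩, hp1⟩, hpσ⟩, fun q => ⟨?_, ?_⟩, hall, hnd⟩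
  · rintro ⟨⟨d', hd', hq⟩, hqx⟩
    rcases (hall _).1 hqx with e | e | e | e
    · exact Or.inl (Q.passage_unique hd' hd hq hσd (Or.inl rfl) (Or.inl e)).2
    · exact Or.inl (Q.passage_unique hd' hd hq hσd (Or.inl rfl) (Or.inr e)).2
    · exact Or.inr (Q.passage_unique hd' hd hq hp (Or.inl rfl) (Or.inl e)).2
    · exact Or.inr (Q.passage_unique hd' hd hq hp (Or.inl rfl) (Or.inr e)).2
  · rintro (rfl | rfl)
    · exact hσ x
    · exact ⟨⟨d, hd, hp⟩, hp1⟩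

theorem isMinus_unique (hC : F.IsEulerSystem C) (hσ : F.IsSigning C σ) {x : V} {p q : H × H}
    (hp : F.IsMinus C σ x p) (hq : F.IsMinus C σ x q) : p = q := by
  obtain ⟨d, hd, r, -, -, -, hr, -⟩ := exists_minus hC hσ x
  exact (((hr p).1 hp.1).resolve_left hp.2).trans (((hr q).1 hq.1).resolve_left hq.2).symm

theorem isMinus_mem (hC : F.IsEulerSystem C) (hσ : F.IsSigning C σ) {x : V} {p : H × H}
    (hp : F.IsMinus C σ x p) {d : Cycle (H × H)} (hd : d ∈ C) (hx : σ x ∈ passages d) :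
    p ∈ passages d := by
  obtain ⟨d', hd', r, h1, h2, hr, -⟩ := exists_minus hC hσ x
  rw [isMinus_unique hC hσ hp hr, (hC.toCircuitPartition.passage_unique hd hd' hx h1
    (Or.inl rfl) (Or.inl rfl)).1]
  exact h2

/-! ### Rows of the standard form as sums of gains. -/

variable (P : F.toMultigraph.CircuitPartition)

/-- Per passage: equal projections cancel, matching the removed traversal; distinct projections at
`y` include `D y` exactly once, with the sign given by its place; away from `y` both indicators
vanish. -/
theorem cycleVector_projWalk {L : List (H × H)}
    (hL : ∀ p ∈ passageList L, F.vert p.1 = F.vert p.2) {D : V → P.TouchHalf} {y : V}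
    (hD : P.touchEdge (D y) = y) :
    (F.touchGraph P).cycleVector D (F.projWalk P (L : Cycle (H × H))) y =
      (L.map (P.gain (D y))).sum := by
  classical
  have key : ∀ p : H × H, F.vert p.1 = F.vert p.2 →
      (if P.proj p.1 ≠ P.proj p.2 then (if P.touchEdge (P.proj p.1) = y then
        (if P.proj p.1 = D y then (1 : ℝ) else -1) else 0) else 0) =
      P.indicator (D y) p.1 - P.indicator (D y) p.2 := by
    intro p hp
    unfold Multigraph.CircuitPartition.indicator
    by_cases h1 : P.proj p.1 = P.proj p.2
    · simp [h1]
    by_cases h2 : P.touchEdge (P.proj p.1) = y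
    · have h3 : P.touchEdge (P.proj p.2) = y := by
        rw [P.touchEdge_proj, ← hp, ← P.touchEdge_proj, h2]
      obtain ⟨a, b, hab, hS⟩ := Set.ncard_eq_two.1 (F.touch_two_halves P y)
      have m1 : P.proj p.1 ∈ ({a, b} : Set _) := hS ▸ h2
      have m2 : P.proj p.2 ∈ ({a, b} : Set _) := hS ▸ h3
      have m3 : D y ∈ ({a, b} : Set _) := hS ▸ hD
      simp only [Set.mem_insert_iff, Set.mem_singleton_iff] at m1 m2 m3
      by_cases h4 : P.proj p.1 = D y
      · have h5 : P.proj p.2 ≠ D y := fun e => h1 (h4.trans e.symm)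
        rw [if_pos h1, if_pos h2, if_pos h4, if_pos h4, if_neg h5, sub_zero]
      · have h5 : P.proj p.2 = D y := by grind
        simp [h2, h4, h5]
    · have h3 : ¬ P.touchEdge (P.proj p.2) = y := by
        rw [P.touchEdge_proj, ← hp, ← P.touchEdge_proj]
        exact h2
      have h4 : P.proj p.1 ≠ D y := fun e => h2 (e ▸ hD)
      have h5 : P.proj p.2 ≠ D y := fun e => h3 (e ▸ hD)
      simp [h2, h4, h5]
  have hsum : ∀ N : List (P.TouchHalf × P.TouchHalf), ∀ f : P.TouchHalf × P.TouchHalf → ℝ,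
      ((N.filter fun t => decide (t.1 ≠ t.2)).map f).sum =
        (N.map fun t => if t.1 ≠ t.2 then f t else 0).sum := by
    intro N f
    induction N with
    | nil => rfl
    | cons t N ih =>
      rw [List.map_cons, List.sum_cons, ← ih, List.filter_cons]
      by_cases h : t.1 = t.2 <;> simp [h]
  have e1 : (F.touchGraph P).cycleVector D (F.projWalk P (L : Cycle (H × H))) y =
      ((((passageList L).map (Prod.map P.proj P.proj)).filter fun t => decide (t.1 ≠ t.2)).map
        fun s => if P.touchEdge s.1 = y then (if s.1 = D y then (1 : ℝ) else -1) else 0).sum := by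
    unfold Multigraph.cycleVector
    rfl
  rw [e1, hsum, List.map_map]
  refine Eq.trans ?_ (sum_passageList (P.indicator (D y)) L)
  refine congrArg List.sum (List.map_congr_left fun p hp => ?_)
  exact key p (hL p hp)

/-- For the transitions of `P` other than `ψ_C`, an Euler circuit projects to a walk in the
touch-graph whose vector vanishes. -/
theorem sum_gain_eq_zero (hC : F.IsEulerSystem C) (hσ : F.IsSigning C σ) {y : V}
    (hP : F.transition P.circuits y ≠ F.psi C y) {M : List (H × H)}
    (hM : (M : Cycle (H × H)) ∈ C) :
    (M.map (P.gain (P.proj (σ y).1))).sum = 0 := by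
  classical
  let Q := hC.toCircuitPartition
  set t := P.proj (σ y).1 with ht
  obtain ⟨d, hd, p, hσd, hpd, hpm, hpass, hall, hnd⟩ := exists_minus hC hσ y
  have hty : P.touchEdge t = y := (P.touchEdge_proj _).trans ((hall _).2 (Or.inl rfl))
  have hvan : ∀ h, F.vert h ≠ y → P.indicator t h = 0 := by
    intro h hh
    refine if_neg fun e => hh ?_
    rw [← P.touchEdge_proj, e, hty]
  set f : H × H → ℝ := fun q => P.indicator t q.1 - P.indicator t q.2 with hf
  have hnodup : (passageList M).Nodup := Q.nodup_passages hM
  have hvp : ∀ q ∈ passageList M, F.vert q.1 = F.vert q.2 := fun q hq => Q.vert_passage hM hq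
  change (M.map fun s => P.indicator t s.2 - P.indicator t s.1).sum = 0
  rw [← sum_passageList, ← List.sum_toFinset _ hnodup]
  have hf0 : ∀ q ∈ (passageList M).toFinset, q ≠ σ y ∧ q ≠ p → f q = 0 := by
    rintro q hq ⟨h1, h2⟩
    rw [List.mem_toFinset] at hq
    have hqy : F.vert q.1 ≠ y := fun e => by
      have := (hpass q).1 ⟨⟨_, hM, hq⟩, e⟩
      tauto
    simp only [hf, hvan _ hqy, hvan _ (fun e => hqy ((hvp q hq).trans e)), sub_self]
  by_cases hdM : d = (M : Cycle (H × H))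
  swap
  · refine Finset.sum_eq_zero fun q hq => hf0 q hq ⟨?_, ?_⟩
    · rintro rfl
      exact hdM (Q.passage_unique hd hM hσd (List.mem_toFinset.1 hq) (Or.inl rfl) (Or.inl rfl)).1
    · rintro rfl
      exact hdM (Q.passage_unique hd hM hpd (List.mem_toFinset.1 hq) (Or.inl rfl) (Or.inl rfl)).1
  subst hdM
  rw [Finset.sum_eq_add (σ y) p hpm.2.symm hf0
    (fun h => absurd (List.mem_toFinset.2 hσd) h) (fun h => absurd (List.mem_toFinset.2 hpd) h)]
  simp only [List.nodup_cons, List.mem_cons, List.not_mem_nil, or_false, not_or] at hnd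
  obtain ⟨⟨n12, n13, n14⟩, ⟨n23, n24⟩, n34, -⟩ := hnd
  -- the mate of a half-edge at `y` in its single transition of `P`
  have mate : ∀ h, F.vert h = y → ∃ k, k ≠ h ∧ F.vert k = y ∧ (P.proj h).1 = s(h, k) := by
    intro h hh
    obtain ⟨a, b, hab, e⟩ := P.touchHalf_pair (P.proj h)
    have hva := P.vert_of_mem (P.proj h) (h := a) (by rw [e]; simp)
    have hvb := P.vert_of_mem (P.proj h) (h := b) (by rw [e]; simp)
    rw [P.touchEdge_proj, hh] at hva hvb
    rcases (P.proj_eq_iff_pair e h).1 rfl with rfl | rfl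
    · exact ⟨b, hab.symm, hvb, e⟩
    · exact ⟨a, hab, hva, e.trans Sym2.eq_swap⟩
  obtain ⟨k, hk, hky, ek⟩ := mate _ ((hall _).2 (Or.inl rfl))
  have hind : ∀ h, P.indicator t h = if h = (σ y).1 ∨ h = k then 1 else 0 := fun h =>
    if_congr (P.proj_eq_iff_pair ek h) rfl rfl
  -- The mate `k` of the arrival of `y⁺` decides. If it is the exit of `y⁺`, both passages
  -- contribute `0`; if it is the arrival of `y⁻`, then `P(y) = ψ_C(y)`; if it is the exit of `y⁻`,
  -- the contributions are `1` and `-1`.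
  rcases (hall k).1 hky with rfl | rfl | rfl | rfl
  · exact absurd rfl hk
  · simp [hf, hind, n12, Ne.symm n12, Ne.symm n13, Ne.symm n14, Ne.symm n23, Ne.symm n24]
  · exfalso
    apply hP
    obtain ⟨l, hl, hly, el⟩ := mate (σ y).2 ((hall _).2 (by simp))
    have hl4 : l = p.2 := by
      have hne : P.proj (σ y).2 ≠ P.proj (σ y).1 := fun e => by
        rcases (P.proj_eq_iff_pair ek _).1 e with e | e
        · exact n12 e.symm
        · exact n23 e
      have hpl : P.proj l = P.proj (σ y).2 := (P.proj_eq_iff_pair el l).2 (Or.inr rfl)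
      rcases (hall l).1 hly with rfl | rfl | rfl | rfl
      · exact absurd hpl.symm hne
      · exact absurd rfl hl
      · exact absurd (hpl.symm.trans ((P.proj_eq_iff_pair ek _).2 (Or.inr rfl))) hne
      · rfl
    subst hl4
    have htrans : ∀ u, u ∈ F.transition P.circuits y ↔
        u = s((σ y).1, p.1) ∨ u = s((σ y).2, p.2) := by
      intro u
      constructor
      · rintro ⟨q, ⟨⟨γ, hγ, hq⟩, hqy⟩, rfl⟩
        have e : (P.proj q.1).1 = s(q.1, q.2) := by
          rw [(P.proj_eq_iff q.1 ⟨s(q.1, q.2), γ, hγ, q, hq, rfl⟩).2 (by simp)]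
        rw [← e, ← ek, ← el]
        rcases (hall q.1).1 hqy with h | h | h | h
        · left; rw [h]
        · right; rw [h]
        · left; rw [h, (P.proj_eq_iff_pair ek p.1).2 (Or.inr rfl)]
        · right; rw [h, (P.proj_eq_iff_pair el p.2).2 (Or.inr rfl)]
      · have aux : ∀ h, F.vert h = y → (P.proj h).1 ∈ F.transition P.circuits y := by
          intro h hh
          obtain ⟨γ, hγ, q, hq, e⟩ := (P.proj h).2
          refine ⟨q, ⟨⟨γ, hγ, hq⟩, ?_⟩, e⟩
          have := P.vert_of_mem (P.proj h) (h := q.1) (by rw [e]; simp)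
          rw [this, P.touchEdge_proj, hh]
        rintro (rfl | rfl)
        · rw [← ek]; exact aux _ ((hall _).2 (by simp))
        · rw [← el]; exact aux _ ((hall _).2 (by simp))
    ext u
    rw [htrans]
    constructor
    · intro hu
      exact ⟨σ y, hσ y, p, hpm.1, hpm.2.symm, hu⟩
    · rintro ⟨q, hq, r, hr, hqr, hu⟩
      rcases (hpass q).1 hq with rfl | rfl <;> rcases (hpass r).1 hr with rfl | rfl
      · exact absurd rfl hqr
      · exact hu
      · rwa [Sym2.eq_swap, Sym2.eq_swap (a := (σ y).2)]
      · exact absurd rfl hqr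
  · simp [hf, hind, n14, n24, n34, Ne.symm n12, Ne.symm n13, Ne.symm n14]

/-- The rows of the standard form are differences of the values of a potential. -/
theorem standardForm_apply (hC : F.IsEulerSystem C) (hσ : F.IsSigning C σ) {x y : V}
    {p : H × H} (hp : F.IsMinus C σ x p) {M : List (H × H)} (hM : (M : Cycle (H × H)) ∈ C)
    (hx : σ x ∈ passageList M) {β : H → ℝ} {a : ℝ}
    (hβ : IsPotential (P.gain (P.proj (σ y).1)) β M a)
    (h0 : (M.map (P.gain (P.proj (σ y).1))).sum = 0) :
    F.standardForm P C σ x y = β (σ x).2 - β p.2 := by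
  let Q := hC.toCircuitPartition
  have hex : ∃ L, F.IsFundamental C σ x L := by
    obtain ⟨A, B, hA, hB, hr, h1, h2⟩ :=
      exists_cut hx (isMinus_mem hC hσ hp hM hx) hp.2.symm
    refine ⟨A, B, hA, hB, ?_, h1, h2 ▸ hp⟩
    rwa [← Cycle.coe_eq_coe.2 hr]
  obtain ⟨L', hL, hL', hmem, h1, h2⟩ := hex.choose_spec
  unfold standardForm Multigraph.fundamentalCircuit
  rw [dif_pos hex]
  -- Only the defining property of the chosen arc is kept: the potential difference does not depend
  -- on the choice.
  generalize hex.choose = L at hL hmem h1 h2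
  have hpl := passageList_append L L' hL hL'
  have hσ' : σ x ∈ passageList (L ++ L') := by rw [hpl]; simp [h1]
  have hcyc : ((L ++ L' : List (H × H)) : Cycle (H × H)) = M :=
    (Q.passage_unique hmem hM hσ' hx (Or.inl rfl) (Or.inl rfl)).1
  have hpe := isMinus_unique hC hσ h2 hp
  have hclosed : ∀ q ∈ passageList L, F.vert q.1 = F.vert q.2 := by
    intro q hq
    rw [passageList_eq L hL, List.mem_append, List.mem_singleton] at hq
    rcases hq with hq | rfl
    · exact Q.vert_passage hmem (p := q) (show q ∈ passageList (L ++ L') by rw [hpl]; simp [hq])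
    · have e1 : F.vert (L.getLast hL).2 = x := by
        have := (hσ x).2
        rwa [← h1] at this
      have e2 : F.vert (L.head hL).1 = x := by
        have := (Q.vert_passage hmem (p := junction L' L hL' hL)
          (show _ ∈ passageList (L ++ L') by rw [hpl]; simp)).symm.trans h2.1.2
        exact this
      exact e1.trans e2.symm
  rw [cycleVector_projWalk P hclosed ((P.touchEdge_proj _).trans (hσ y).2)]
  obtain ⟨b, hb⟩ := hβ.isRotated h0 (Cycle.coe_eq_coe.1 hcyc).symm
  rw [hb.sum_eq hL hL', ← h1, ← hpe]
  rfl

/-- Serves `v` and `w`, whose arcs are given explicitly. -/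
theorem standardForm_eq_sum (hC : F.IsEulerSystem C) (hσ : F.IsSigning C σ) {x y : V}
    {A B : List (H × H)} (hA : A ≠ []) (hB : B ≠ [])
    (hM : ((A ++ B : List (H × H)) : Cycle (H × H)) ∈ C) (hx : junction A B hA hB = σ x)
    (hm : F.IsMinus C σ x (junction B A hB hA))
    (h0 : ((A ++ B).map (P.gain (P.proj (σ y).1))).sum = 0) :
    F.standardForm P C σ x y = (A.map (P.gain (P.proj (σ y).1))).sum := by
  obtain ⟨β, hβ⟩ := exists_isPotential (P.gain (P.proj (σ y).1))
    (hC.toCircuitPartition.nodup_map_fst hM) 0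
  have hpl := passageList_append A B hA hB
  rw [standardForm_apply P hC hσ hm hM (by rw [hpl]; simp [hx]) hβ h0, hβ.sum_eq hA hB, ← hx]
  rfl

end FourRegularGraph

/-! ### Signed interlacement through arc indicators. -/

open Classical in
/-- The indicator function of the half-edges along which the steps of `L` leave. -/
noncomputable def arcIndicator {H : Type*} (L : List (H × H)) (h : H) : ℝ :=
  if h ∈ L.map Prod.fst then 1 else 0

namespace Multigraph

variable {V E H : Type*} {G : Multigraph V E H}

/-- A circuit repeats no passage, so in any listing the two junctions separate the same two arcs. -/
theorem CircuitPartition.occurInOrder_iff (Q : G.CircuitPartition) {A B : List (H × H)}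
    (hA : A ≠ []) (hB : B ≠ []) (hM : ((A ++ B : List (H × H)) : Cycle (H × H)) ∈ Q.circuits)
    (a b : H × H) :
    OccurInOrder Q.circuits a (junction A B hA hB) b (junction B A hB hA) ↔
      a ∈ innerPassages A ∧ b ∈ innerPassages B := by
  have hpl := passageList_append A B hA hB
  constructor
  · rintro ⟨γ, hγ, L, hL, hs⟩
    have hj : junction A B hA hB ∈ passages γ := by
      rw [hL]
      exact hs.subset (by simp)
    have e := (Q.passage_unique hγ hM hj (q := junction A B hA hB)
      (show _ ∈ passageList (A ++ B) by rw [hpl]; simp) (Or.inl rfl) (Or.inl rfl)).1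
    subst e
    have hn := Q.nodup_passages hγ
    rw [hL] at hn
    have hr : L.IsRotated (passageList (A ++ B)) := (Cycle.coe_eq_coe.1 hL).symm
    rw [hpl] at hr
    exact mem_arcs_of_sublist hn hr hs
  · rintro ⟨ha, hb⟩
    refine ⟨_, hM, passageList (A ++ B), rfl, ?_⟩
    rw [hpl]
    have h1 : [a].Sublist (innerPassages A) := List.singleton_sublist.2 ha
    have h2 : [b].Sublist (innerPassages B) := List.singleton_sublist.2 hb
    exact h1.append ((h2.append (List.Sublist.refl [_])).cons_cons _)

end Multigraph

namespace FourRegularGraph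

variable {V E H : Type*} {F : FourRegularGraph V E H} {C : Set (Cycle (H × H))} {σ : V → H × H}

/-- The signed interlacement counts on which of the two arcs between `w⁺` and `w⁻` the passages
`x⁺` and `x⁻` are. -/
theorem signedInterlacement_eq (hC : F.IsEulerSystem C) (hσ : F.IsSigning C σ) {x w : V}
    (hxw : x ≠ w) {p : H × H} (hp : F.IsMinus C σ x p) {A B : List (H × H)} (hA : A ≠ [])
    (hB : B ≠ []) (hM : ((A ++ B : List (H × H)) : Cycle (H × H)) ∈ C)
    (hw_plus : junction B A hB hA = σ w) (hw_minus : F.IsMinus C σ w (junction A B hA hB)) :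
    F.signedInterlacement C σ x w = arcIndicator A (σ x).2 - arcIndicator A p.2 := by
  let Q := hC.toCircuitPartition
  have hM' : ((B ++ A : List (H × H)) : Cycle (H × H)) ∈ C := by
    rwa [Cycle.coe_eq_coe.2 (List.isRotated_append (l := B) (l' := A))]
  have hpl := passageList_append A B hA hB
  have c1 : (∃ p q, F.IsMinus C σ x p ∧ F.IsMinus C σ w q ∧ OccurInOrder C (σ x) q p (σ w)) ↔
      σ x ∈ innerPassages A ∧ p ∈ innerPassages B := by
    rw [← Q.occurInOrder_iff hA hB hM, hw_plus]
    constructor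
    · rintro ⟨p', q, hp', hq, h⟩
      rwa [isMinus_unique hC hσ hp hp', isMinus_unique hC hσ hw_minus hq]
    · exact fun h => ⟨p, _, hp, hw_minus, h⟩
  have c2 : (∃ p q, F.IsMinus C σ x p ∧ F.IsMinus C σ w q ∧ OccurInOrder C (σ x) (σ w) p q) ↔
      σ x ∈ innerPassages B ∧ p ∈ innerPassages A := by
    rw [← Q.occurInOrder_iff hB hA hM', hw_plus]
    constructor
    · rintro ⟨p', q, hp', hq, h⟩
      rwa [isMinus_unique hC hσ hp hp', isMinus_unique hC hσ hw_minus hq]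
    · exact fun h => ⟨p, _, hp, hw_minus, h⟩
  have hnd : ((A ++ B).map Prod.fst).Nodup := Q.nodup_map_fst hM
  rw [List.map_append, List.nodup_append'] at hnd
  -- Half-edges of departure do not repeat, so the exit of an inner passage tells which arc contains
  -- it.
  have inA : ∀ q ∈ innerPassages A, arcIndicator A q.2 = 1 := fun q hq =>
    if_pos (innerPassages_snd_mem hq)
  have inB : ∀ q ∈ innerPassages B, arcIndicator A q.2 = 0 := fun q hq =>
    if_neg fun h => hnd.2.2 h (innerPassages_snd_mem hq)
  have disj : ∀ q ∈ innerPassages A, q ∉ innerPassages B := fun q hq h =>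
    hnd.2.2 (innerPassages_snd_mem hq) (innerPassages_snd_mem h)
  unfold Multigraph.signedInterlacement
  rw [if_neg hxw, c1, c2]
  by_cases hx : σ x ∈ passages ((A ++ B : List (H × H)) : Cycle (H × H))
  · have hor : ∀ q ∈ passageList (A ++ B), F.vert q.1 = x →
        q ∈ innerPassages A ∨ q ∈ innerPassages B := by
      intro q hq hqx
      rw [hpl] at hq
      simp only [List.mem_append, List.mem_cons, List.not_mem_nil, or_false] at hq
      rcases hq with h | rfl | h | rfl
      · exact Or.inl h
      · exact absurd (hqx.symm.trans hw_minus.1.2) hxw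
      · exact Or.inr h
      · rw [hw_plus] at hqx
        exact absurd (hqx.symm.trans (hσ w).2) hxw
    have hpx := isMinus_mem hC hσ hp hM hx
    rcases hor _ hx (hσ x).2 with h1 | h1 <;> rcases hor _ hpx hp.1.2 with h2 | h2
    · rw [if_neg fun h => disj _ h2 h.2, if_neg fun h => disj _ h1 h.1, inA _ h1, inA _ h2,
        sub_self]
    · rw [if_pos ⟨h1, h2⟩, inA _ h1, inB _ h2, sub_zero]
    · rw [if_neg fun h => disj _ h.1 h1, if_pos ⟨h1, h2⟩, inB _ h1, inA _ h2, zero_sub]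
    · rw [if_neg fun h => disj _ h.1 h1, if_neg fun h => disj _ h.2 h2, inB _ h1, inB _ h2,
        sub_self]
  · obtain ⟨d, hd, p', hσd, hpd, hp', -⟩ := exists_minus hC hσ x
    obtain rfl := isMinus_unique hC hσ hp hp'
    have off : ∀ q ∈ passages d, arcIndicator A q.2 = 0 := by
      intro q hq
      refine if_neg fun h => hx ?_
      obtain ⟨s, hs, e⟩ := List.mem_map.1 h
      obtain ⟨r, hr, e'⟩ := (exists_passage_snd
        ((A ++ B : List (H × H)) : Cycle (H × H)) q.2).2 ⟨s, by simp [hs], e⟩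
      rw [← (Q.passage_unique hd hM hq hr (h := q.2) (Or.inr rfl) (Or.inr e'.symm)).1]
      exact hσd
    rw [if_neg fun h => hx ?_, if_neg fun h => hx ?_, off _ hσd, off _ hpd, sub_self]
    · show σ x ∈ passageList (A ++ B)
      rw [hpl]
      simp [h.1]
    · show σ x ∈ passageList (A ++ B)
      rw [hpl]
      simp [h.1]

end FourRegularGraph

/-! ### Effect of exchanging arcs on Euler systems and potentials. -/

namespace Multigraph

variable {V E H : Type*} {G : Multigraph V E H} {C : Set (Cycle (H × H))}

/-- Whether a circuit is an Euler circuit of a component depends only on the edges it traverses. -/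
theorem IsEulerSystem.replace (hC : G.IsEulerSystem C) {c c' : Cycle (H × H)} (hc : c ∈ C)
    (hc' : G.IsCircuit c') (ht : ∀ e, G.Traverses c' e ↔ G.Traverses c e) :
    G.IsEulerSystem (C \ {c} ∪ {c'}) := by
  have hcc : G.IsCircuit c := (hC.1 c hc).choose_spec.1
  have key : ∀ x, G.IsEulerCircuitAt c' x ↔ G.IsEulerCircuitAt c x := fun x =>
    ⟨fun h => ⟨hcc, fun e => (ht e).symm.trans (h.2 e)⟩, fun h => ⟨hc', fun e => (ht e).trans (h.2 e)⟩⟩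
  constructor
  · rintro d (⟨hd, -⟩ | rfl)
    · exact hC.1 d hd
    · obtain ⟨x, hx⟩ := hC.1 c hc
      exact ⟨x, (key x).2 hx⟩
  · intro x
    obtain ⟨d, ⟨hd, hdx⟩, hu⟩ := hC.2 x
    by_cases hdc : d = c
    · subst hdc
      refine ⟨c', ⟨Or.inr rfl, (key x).2 hdx⟩, ?_⟩
      rintro e ⟨⟨he, hne⟩ | rfl, hex⟩
      · exact absurd (hu e ⟨he, hex⟩) hne
      · rfl
    · refine ⟨d, ⟨Or.inl ⟨hd, hdc⟩, hdx⟩, ?_⟩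
      rintro e ⟨⟨he, hne⟩ | rfl, hex⟩
      · exact hu e ⟨he, hex⟩
      · exact absurd (hu c ⟨hc, (key x).1 hex⟩).symm hdc

/-- Exchanging two arcs between the same two vertices gives a circuit. -/
theorem IsCircuit.transpose {A₁ A₂ A₃ A₄ : List (H × H)} (hA₁ : A₁ ≠ []) (hA₂ : A₂ ≠ [])
    (hA₃ : A₃ ≠ []) (hA₄ : A₄ ≠ [])
    (hc : G.IsCircuit ((A₁ ++ A₂ ++ A₃ ++ A₄ : List (H × H)) : Cycle (H × H)))
    (hv : G.vert (junction A₄ A₁ hA₄ hA₁).1 = G.vert (junction A₂ A₃ hA₂ hA₃).1)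
    (hw : G.vert (junction A₁ A₂ hA₁ hA₂).1 = G.vert (junction A₃ A₄ hA₃ hA₄).1) :
    G.IsCircuit ((A₃ ++ A₂ ++ A₁ ++ A₄ : List (H × H)) : Cycle (H × H)) := by
  obtain ⟨h1, ⟨h2, h3⟩, h4⟩ := hc
  have hperm : (A₃ ++ A₂ ++ A₁ ++ A₄).Perm (A₁ ++ A₂ ++ A₃ ++ A₄) := by
    refine List.Perm.append_right _ ?_
    rw [List.append_assoc A₁]
    exact List.perm_append_comm.trans (List.perm_append_comm.append_left _)
  have h3' : ∀ q ∈ passageList (A₁ ++ A₂ ++ A₃ ++ A₄), G.vert q.1 = G.vert q.2 := h3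
  simp only [mem_passageList_append₄ hA₁ hA₂ hA₃ hA₄] at h3'
  have e1 := h3' (junction A₁ A₂ hA₁ hA₂) (by simp)
  have e2 := h3' (junction A₂ A₃ hA₂ hA₃) (by simp)
  have e3 := h3' (junction A₃ A₄ hA₃ hA₄) (by simp)
  have e4 := h3' (junction A₄ A₁ hA₄ hA₁) (by simp)
  refine ⟨by simp [hA₁], ⟨fun s hs => h2 s (hperm.mem_iff.1 hs), ?_⟩, (hperm.map _).nodup_iff.2 h4⟩
  intro q hq
  change q ∈ passageList (A₃ ++ A₂ ++ A₁ ++ A₄) at hq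
  rw [mem_passageList_append₄ hA₃ hA₂ hA₁ hA₄] at hq
  rcases hq with h | rfl | rfl | rfl | rfl
  · exact h3' q (Or.inl (by tauto))
  · exact hw.symm.trans e1
  · exact hv.symm.trans e4
  · exact hw.trans e3
  · exact hv.trans e2

end Multigraph

/-- How the potential along a closed walk changes when two arcs are exchanged. -/
theorem IsPotential.transpose {H : Type*} {g : H × H → ℝ} {β : H → ℝ}
    {A₁ A₂ A₃ A₄ : List (H × H)} (h : IsPotential g β (A₁ ++ A₂ ++ A₃ ++ A₄) 0)
    (hn : ((A₁ ++ A₂ ++ A₃ ++ A₄).map Prod.fst).Nodup)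
    (h0 : ((A₁ ++ A₂ ++ A₃ ++ A₄).map g).sum = 0) :
    IsPotential g (fun k => β k + arcIndicator (A₂ ++ A₃) k * ((A₃ ++ A₄).map g).sum
      - arcIndicator (A₁ ++ A₂) k * ((A₄ ++ A₁).map g).sum) (A₃ ++ A₂ ++ A₁ ++ A₄) 0 := by
  simp only [isPotential_append, List.map_append, List.sum_append] at h h0 ⊢
  obtain ⟨⟨⟨h1, h2⟩, h3⟩, h4⟩ := h
  simp only [List.map_append, List.nodup_append, List.mem_append] at hn
  have i1 : ∀ k ∈ A₁.map Prod.fst,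
      arcIndicator (A₂ ++ A₃) k = 0 ∧ arcIndicator (A₁ ++ A₂) k = 1 := by
    intro k hk
    exact ⟨if_neg (by rw [List.map_append, List.mem_append]; grind), if_pos (List.map_append ▸ List.mem_append.2 (Or.inl hk))⟩
  have i2 : ∀ k ∈ A₂.map Prod.fst,
      arcIndicator (A₂ ++ A₃) k = 1 ∧ arcIndicator (A₁ ++ A₂) k = 1 := by
    intro k hk
    exact ⟨if_pos (List.map_append ▸ List.mem_append.2 (Or.inl hk)), if_pos (List.map_append ▸ List.mem_append.2 (Or.inr hk))⟩
  have i3 : ∀ k ∈ A₃.map Prod.fst,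
      arcIndicator (A₂ ++ A₃) k = 1 ∧ arcIndicator (A₁ ++ A₂) k = 0 := by
    intro k hk
    exact ⟨if_pos (List.map_append ▸ List.mem_append.2 (Or.inr hk)), if_neg (by rw [List.map_append, List.mem_append]; grind)⟩
  have i4 : ∀ k ∈ A₄.map Prod.fst,
      arcIndicator (A₂ ++ A₃) k = 0 ∧ arcIndicator (A₁ ++ A₂) k = 0 := by
    intro k hk
    exact ⟨if_neg (by rw [List.map_append, List.mem_append]; grind), if_neg (by rw [List.map_append, List.mem_append]; grind)⟩
  -- With `aᵢ` the sum over `Aᵢ` and total `0`, the starting values move by `-(a₁ + a₂) = a₃ + a₄`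
  -- on `A₃`, `a₃ - a₁` on `A₂`, `a₂ + a₃ = -(a₄ + a₁)` on `A₁`, and `0` on `A₄`.
  refine ⟨⟨⟨?_, ?_⟩, ?_⟩, ?_⟩
  · convert h3.congr (k := (A₃.map g).sum + (A₄.map g).sum) fun k hk => ?_ using 1
    · linarith
    · rw [(i3 k hk).1, (i3 k hk).2]; ring
  · convert h2.congr (k := (A₃.map g).sum - (A₁.map g).sum) fun k hk => ?_ using 1
    · ring
    · rw [(i2 k hk).1, (i2 k hk).2]; ring
  · convert h1.congr (k := -((A₄.map g).sum + (A₁.map g).sum)) fun k hk => ?_ using 1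
    · linarith
    · rw [(i1 k hk).1, (i1 k hk).2]; ring
  · convert h4.congr (k := 0) fun k hk => ?_ using 1
    · ring
    · rw [(i4 k hk).1, (i4 k hk).2]; ring

/-! ### The row identities. -/

theorem mainTheorem4 {V E H : Type*} (F : FourRegularGraph V E H)
    (C : Set (Cycle (H × H))) (hC : F.IsEulerSystem C)
    (σ : V → H × H) (hσ : F.IsSigning C σ)
    (v w : V) (A₁ A₂ A₃ A₄ : List (H × H))
    (hA₁ : A₁ ≠ []) (hA₂ : A₂ ≠ []) (hA₃ : A₃ ≠ []) (hA₄ : A₄ ≠ [])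
    (hvw : v ≠ w)
    (hcirc : ((A₁ ++ A₂ ++ A₃ ++ A₄ : List (H × H)) : Cycle (H × H)) ∈ C)
    (hv_plus : junction A₄ A₁ hA₄ hA₁ = σ v)
    (hw_plus : junction A₁ A₂ hA₁ hA₂ = σ w)
    (hv_minus : F.IsMinus C σ v (junction A₂ A₃ hA₂ hA₃))
    (hw_minus : F.IsMinus C σ w (junction A₃ A₄ hA₃ hA₄))
    (C' : Set (Cycle (H × H))) (hC' : C' = transposition C A₁ A₂ A₃ A₄)
    (σ' : V → H × H)
    (hσ' : σ' = resign σ v w (junction A₄ A₃ hA₄ hA₃) (junction A₁ A₄ hA₁ hA₄))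
    (P : F.CircuitPartition)
    (hP : ∀ x, F.transition P.circuits x ≠ F.psi C x) :
    F.IsEulerSystem C' ∧ F.IsSigning C' σ' ∧
      F.standardForm P C' σ' v = F.standardForm P C σ w ∧
      F.standardForm P C' σ' w = -F.standardForm P C σ v ∧
      ∀ x, x ≠ v → x ≠ w →
        F.standardForm P C' σ' x =
          F.standardForm P C σ x
            + F.signedInterlacement C σ x w • F.standardForm P C σ v
            - F.signedInterlacement C σ x v • F.standardForm P C σ w := by
  let Q := hC.toCircuitPartition
  have hjv : F.vert (junction A₄ A₁ hA₄ hA₁).1 = v := by rw [hv_plus]; exact (hσ v).2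
  have hjw : F.vert (junction A₁ A₂ hA₁ hA₂).1 = w := by rw [hw_plus]; exact (hσ w).2
  have hperm : (A₃ ++ A₂ ++ A₁ ++ A₄).Perm (A₁ ++ A₂ ++ A₃ ++ A₄) := by
    refine List.Perm.append_right _ ?_
    rw [List.append_assoc A₁]
    exact List.perm_append_comm.trans (List.perm_append_comm.append_left _)
  have hE : F.IsEulerSystem C' := by
    rw [hC']
    refine hC.replace hcirc ((Q.isCircuit _ hcirc).transpose hA₁ hA₂ hA₃ hA₄
      (hjv.trans hv_minus.1.2.symm) (hjw.trans hw_minus.1.2.symm)) fun e => ?_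
    exact exists_congr fun s => and_congr_left fun _ => hperm.mem_iff
  have hcirc' : ((A₃ ++ A₂ ++ A₁ ++ A₄ : List (H × H)) : Cycle (H × H)) ∈ C' := by
    rw [hC']; exact Or.inr rfl
  have hmem := mem_passageList_append₄ hA₁ hA₂ hA₃ hA₄
  have hmem' := mem_passageList_append₄ hA₃ hA₂ hA₁ hA₄
  have hpass : ∀ x, x ≠ v → x ≠ w → F.passagesAt C x ⊆ F.passagesAt C' x := by
    rintro x hxv hxw q ⟨⟨d, hd, hq⟩, hqx⟩
    refine ⟨?_, hqx⟩
    by_cases hdc : d = ((A₁ ++ A₂ ++ A₃ ++ A₄ : List (H × H)) : Cycle (H × H))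
    · subst hdc
      refine ⟨_, hcirc', (hmem' q).2 (Or.inl ?_)⟩
      rcases (hmem q).1 hq with h | rfl | rfl | rfl | rfl
      · tauto
      · exact absurd (hqx.symm.trans hjw) hxw
      · exact absurd (hqx.symm.trans hv_minus.1.2) hxv
      · exact absurd (hqx.symm.trans hw_minus.1.2) hxw
      · exact absurd (hqx.symm.trans hjv) hxv
    · exact ⟨d, by rw [hC']; exact Or.inl ⟨hd, hdc⟩, hq⟩
  have hσv : σ' v = junction A₄ A₃ hA₄ hA₃ := by rw [hσ']; simp [resign]
  have hσw : σ' w = junction A₁ A₄ hA₁ hA₄ := by rw [hσ']; simp [resign, hvw.symm]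
  have hσx : ∀ x, x ≠ v → x ≠ w → σ' x = σ x := fun x h1 h2 => by rw [hσ']; simp [resign, h1, h2]
  have hS : F.IsSigning C' σ' := by
    intro x
    by_cases hxv : x = v
    · subst hxv
      rw [hσv]
      exact ⟨⟨_, hcirc', (hmem' _).2 (by simp)⟩, hjv⟩
    by_cases hxw : x = w
    · subst hxw
      rw [hσw]
      exact ⟨⟨_, hcirc', (hmem' _).2 (by simp)⟩, hjw⟩
    rw [hσx x hxv hxw]
    exact hpass x hxv hxw (hσ x)
  -- `v⁺` still arrives at the end of `A₄` and `w⁺` at the end of `A₁`, so the touch-graph keeps its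
  -- directions and both matrices use the same gains.
  have hfst : ∀ y, (σ' y).1 = (σ y).1 := by
    intro y
    by_cases hyv : y = v
    · rw [hyv, hσv, ← hv_plus]; rfl
    by_cases hyw : y = w
    · rw [hyw, hσw, ← hw_plus]; rfl
    rw [hσx y hyv hyw]
  have h0 : ∀ y, ((A₁ ++ A₂ ++ A₃ ++ A₄).map (P.gain (P.proj (σ y).1))).sum = 0 := fun y =>
    FourRegularGraph.sum_gain_eq_zero P hC hσ (hP y) hcirc
  have rot : ∀ A B : List (H × H), ((A ++ B : List (H × H)) : Cycle (H × H)) = (B ++ A : List _) :=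
    fun A B => Cycle.coe_eq_coe.2 List.isRotated_append
  have n12 : A₁ ++ A₂ ≠ [] := by simp [hA₁]
  have n23 : A₂ ++ A₃ ≠ [] := by simp [hA₂]
  have n34 : A₃ ++ A₄ ≠ [] := by simp [hA₃]
  have n41 : A₄ ++ A₁ ≠ [] := by simp [hA₄]
  have n14 : A₁ ++ A₄ ≠ [] := by simp [hA₁]
  have n32 : A₃ ++ A₂ ≠ [] := by simp [hA₃]
  have n21 : A₂ ++ A₁ ≠ [] := by simp [hA₂]
  have n43 : A₄ ++ A₃ ≠ [] := by simp [hA₄]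
  have jun : ∀ (A B A' B' : List (H × H)) (hA : A ≠ []) (hB : B ≠ []) (hA' : A' ++ A ≠ [])
      (hB' : B ++ B' ≠ []), junction (A' ++ A) (B ++ B') hA' hB' = junction A B hA hB :=
    fun A B A' B' hA hB hA' hB' => by
      rw [junction_append_left _ _ _ hA, junction_append_right _ _ _ _ hB]
  have c2341 : ((A₂ ++ A₃ ++ (A₄ ++ A₁) : List (H × H)) : Cycle (H × H)) ∈ C := by
    rw [← List.append_assoc, rot]
    simpa using hcirc
  have c1234 : ((A₁ ++ A₂ ++ (A₃ ++ A₄) : List (H × H)) : Cycle (H × H)) ∈ C := by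
    simpa using hcirc
  have rowv : ∀ y, F.standardForm P C σ v y =
      ((A₃ ++ A₄).map (P.gain (P.proj (σ y).1))).sum := by
    intro y
    refine FourRegularGraph.standardForm_eq_sum P hC hσ n34 n12 (by rwa [rot])
      ((jun _ _ _ _ hA₄ hA₁ _ _).trans hv_plus) ?_ ?_
    · rwa [jun _ _ _ _ hA₂ hA₃]
    · rw [← h0 y]
      simp only [List.map_append, List.sum_append]
      ring
  have roww : ∀ y, F.standardForm P C σ w y =
      ((A₄ ++ A₁).map (P.gain (P.proj (σ y).1))).sum := by
    intro y
    refine FourRegularGraph.standardForm_eq_sum P hC hσ n41 n23 (by rwa [rot])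
      ((jun _ _ _ _ hA₁ hA₂ _ _).trans hw_plus) ?_ ?_
    · rwa [jun _ _ _ _ hA₃ hA₄]
    · rw [← h0 y]
      simp only [List.map_append, List.sum_append]
      ring
  refine ⟨hE, hS, ?_, ?_, ?_⟩
  · funext y
    rw [roww, FourRegularGraph.standardForm_eq_sum P hE hS n14 n32
      (by rw [rot]; simpa using hcirc') ((jun _ _ _ _ hA₄ hA₃ _ _).trans hσv.symm), hfst]
    · simp only [List.map_append, List.sum_append]
      ring
    · rw [jun _ _ _ _ hA₂ hA₁]
      -- The new `v⁻` arrives as the old one did; if it were the new `v⁺`, the old `v⁺` and `v⁻`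
      -- would share their arrival.
      refine ⟨⟨⟨_, hcirc', (hmem' _).2 (by simp)⟩, hv_minus.1.2⟩, fun e => hv_minus.2 ?_⟩
      rw [← hv_plus]
      refine (Q.passage_unique hcirc hcirc ((hmem _).2 (by simp)) ((hmem _).2 (by simp))
        (Or.inl rfl) (Or.inl ?_)).2
      have := congrArg Prod.fst (e.trans hσv)
      exact this
    · rw [hfst, ← h0 y]
      simp only [List.map_append, List.sum_append]
      ring
  · funext y
    rw [Pi.neg_apply, rowv, FourRegularGraph.standardForm_eq_sum P hE hS n21 n43
      (by rw [← List.append_assoc, rot]; simpa using hcirc')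
      ((jun _ _ _ _ hA₁ hA₄ _ _).trans hσw.symm), hfst]
    · have := h0 y
      simp only [List.map_append, List.sum_append] at this ⊢
      linarith
    · rw [jun _ _ _ _ hA₃ hA₂]
      refine ⟨⟨⟨_, hcirc', (hmem' _).2 (by simp)⟩, hw_minus.1.2⟩, fun e => hw_minus.2 ?_⟩
      rw [← hw_plus]
      refine (Q.passage_unique hcirc hcirc ((hmem _).2 (by simp)) ((hmem _).2 (by simp))
        (Or.inl rfl) (Or.inl ?_)).2
      have := congrArg Prod.fst (e.trans hσw)
      exact this
    · rw [hfst, ← h0 y]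
      simp only [List.map_append, List.sum_append]
      ring
  · intro x hxv hxw
    funext y
    obtain ⟨d, hd, p, hσd, hpd, hp, -⟩ := FourRegularGraph.exists_minus hC hσ x
    have hp' : F.IsMinus C' σ' x p :=
      ⟨hpass x hxv hxw hp.1, by rw [hσx x hxv hxw]; exact hp.2⟩
    have hIw := FourRegularGraph.signedInterlacement_eq hC hσ hxw hp n23 n41 c2341
      ((jun _ _ _ _ hA₁ hA₂ _ _).trans hw_plus) (by rwa [jun _ _ _ _ hA₃ hA₄])
    have hIv := FourRegularGraph.signedInterlacement_eq hC hσ hxv hp n12 n34 c1234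
      ((jun _ _ _ _ hA₄ hA₁ _ _).trans hv_plus) (by rwa [jun _ _ _ _ hA₂ hA₃])
    simp only [Pi.add_apply, Pi.sub_apply, Pi.smul_apply, smul_eq_mul]
    by_cases hdc : d = ((A₁ ++ A₂ ++ A₃ ++ A₄ : List (H × H)) : Cycle (H × H))
    · subst hdc
      have hn := Q.nodup_map_fst hd
      obtain ⟨β, hβ⟩ := exists_isPotential (P.gain (P.proj (σ y).1)) hn 0
      have hσd' : σ x ∈ passageList (A₃ ++ A₂ ++ A₁ ++ A₄) := by
        refine (hmem' _).2 (Or.inl ?_)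
        rcases (hmem _).1 hσd with h | h | h | h | h
        · tauto
        · exact absurd ((hσ x).2.symm.trans (by rw [h, hjw])) hxw
        · exact absurd ((hσ x).2.symm.trans (by rw [h, hv_minus.1.2])) hxv
        · exact absurd ((hσ x).2.symm.trans (by rw [h, hw_minus.1.2])) hxw
        · exact absurd ((hσ x).2.symm.trans (by rw [h, hjv])) hxv
      have hβ' := hβ.transpose hn (h0 y)
      -- The total gain of the new circuit vanishes because its steps are those of the old one; no
      -- comparison of `P` with `ψ` for `C'` is needed.
      rw [FourRegularGraph.standardForm_apply P hC hσ hp hd hσd hβ (h0 y),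
        FourRegularGraph.standardForm_apply P hE hS hp' hcirc' (by rwa [hσx x hxv hxw])
          (by rw [hfst]; exact hβ') (by rw [hfst, ← h0 y]; exact (hperm.map _).sum_eq),
        hσx x hxv hxw, hIw, hIv, rowv, roww]
      ring
    -- If `x` is on another circuit, both interlacements vanish, and that circuit with its potential
    -- belongs to both systems.
    · have off : ∀ (A : List (H × H)), A ⊆ A₁ ++ A₂ ++ A₃ ++ A₄ → ∀ q ∈ passages d,
          arcIndicator A q.2 = 0 := by
        intro A hA q hq
        refine if_neg fun h => hdc ?_
        obtain ⟨s, hs, e⟩ := List.mem_map.1 h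
        obtain ⟨r, hr, e'⟩ := (exists_passage_snd
          ((A₁ ++ A₂ ++ A₃ ++ A₄ : List (H × H)) : Cycle (H × H)) q.2).2 ⟨s, hA hs, e⟩
        exact (Q.passage_unique hd hcirc hq hr (h := q.2) (Or.inr rfl) (Or.inr e'.symm)).1
      have s23 : A₂ ++ A₃ ⊆ A₁ ++ A₂ ++ A₃ ++ A₄ := fun s hs => by simp at hs ⊢; tauto
      have s12 : A₁ ++ A₂ ⊆ A₁ ++ A₂ ++ A₃ ++ A₄ := fun s hs => by simp at hs ⊢; tauto
      rw [hIw, hIv, off _ s23 _ hσd, off _ s23 _ hpd, off _ s12 _ hσd, off _ s12 _ hpd]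
      induction d using Quotient.inductionOn' with
      | h M =>
        obtain ⟨β, hβ⟩ := exists_isPotential (P.gain (P.proj (σ y).1)) (Q.nodup_map_fst hd) 0
        have hM0 := FourRegularGraph.sum_gain_eq_zero P hC hσ (hP y) hd
        rw [FourRegularGraph.standardForm_apply P hC hσ hp hd hσd hβ hM0,
          FourRegularGraph.standardForm_apply P hE hS hp' (M := M)
            (by rw [hC']; exact Or.inl ⟨hd, hdc⟩) (by rwa [hσx x hxv hxw])
            (by rw [hfst]; exact hβ) (by rw [hfst]; exact hM0), hσx x hxv hxw]
        ring
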